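/- Conventions. An enhanced 2-category is a (strict) 2-category $\mathcal K$ with a class of *tight* 1-cells containing the identities and closed under composition. A *left-tight pullback* is a strict 2-pullback whose left leg is tight and detects tightness (if $p\circ h$ is tight then so is $h$). A *discrete opfibration* is a 1-cell $p:E\to B$ such that every 2-cell $\varphi : p e\Rightarrow b$ lifts to a unique 2-cell $e\Rightarrow e'$. $\mathcal K$ is a *plumbus* if it has a terminal object (in the 2-categorical sense) with tight maps into it, and left-tight pullbacks of tight discrete opfibrations along arbitrary 1-cells. A class of *small* discrete opfibrations is a replete class of tight discrete opfibrations, stable under left-tight pullback and containing $\mathrm{id}_1$. A *2-classifier* is a small discrete opfibration $u:\Omega_\bullet\to\Omega$ such that for all $B$ the functor $f\mapsto f^*u$ from $\mathcal K(B,\Omega)$ to tight discrete opfibrations over $B$ is fully faithful, with the small ones as essential image; $f$ is a *classifying map* of $p$ if $p$ is a left-tight pullback of $u$ along $f$. An *enhanced 2-monad* $(T,i,m)$ is a 2-monad such that $T$ preserves tight 1-cells and $i,m$ have tight components. $\mathrm{Alg}_{\mathrm{lx}}(T)$ is the enhanced 2-category of strict $T$-algebras with tight structure map, lax $T$-morphisms,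 and $T$-2-morphisms; its tight 1-cells are the strict $T$-morphisms with tight underlying 1-cell. Let $\mathcal K$ be a plumbus with a class of small discrete opfibrations and a 2-classifier $u:\Omega_\bullet\to\Omega$, and let $(T,i,m)$ be an enhanced 2-monad on $\mathcal K$ such that: $Tu$ is small; $T$ sends left-tight pullbacks of $u$ to 2-pullbacks; the naturality squares of $i$ and $m$ at $u$ are 2-pullbacks; $Tu$ has a tight classifying map $\omega:T\Omega\to\Omega$, with corresponding map $\omega_\bullet:T\Omega_\bullet\to\Omega_\bullet$ over it; and $(\Omega,\omega)$ is a strict $T$-algebra. Let $(X,\xi)$ and $(B,\beta)$ be strict $T$-algebras with tight structure maps, let $b:X\to B$ be a colax $T$-morphism with colaxator $\bar b: b\,\xi\Rightarrow \beta\, Tb$, and let $b/B$ be a comma object of $b$ and $\mathrm{id}_B$ in $\mathcal K$, with universal 2-cell $\chi: b\,\partial_0\Rightarrow\partial_1$, such that $\partial_1:b/B\to B$ is a small discrete opfibration. Let $\bar b/\beta:T(b/B)\to b/B$ be the 1-cell induced by the universal property from $\xi\,T\partial_0$, $\beta\,T\partial_1$ and the 2-cell $(\beta\, T\chi)\cdot(\bar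 b\,T\partial_0)$. The algebra $B$ is *$T$-cartesian at $b$* if $\partial_1:(b/B,\bar b/\beta)\to(B,\beta)$ is $T$-cartesian, i.e. the comparison $\delta$ from $T(b/B)$ to the pullback of $\partial_1$ along $\beta$ induced by $\bar b/\beta$ and $T\partial_1$ is a split equivalence: there is $s$ with $\delta s=\mathrm{id}$ and $s\delta\cong\mathrm{id}$. Then $(\Omega_\bullet,\omega_\bullet)$ and $(b/B,\bar b/\beta)$ are strict $T$-algebras with tight structure maps, $u$ and $\partial_1$ are strict $T$-morphisms, and $\partial_1$ is a tight discrete opfibration in $\mathrm{Alg}_{\mathrm{lx}}(T)$. Moreover, let $B(b,-):B\to\Omega$ be any classifying map of $\partial_1$ in $\mathcal K$, exhibited by a left-tight pullback square with top side $e:b/B\to\Omega_\bullet$. Then: 1. there is exactly one lax $T$-morphism structure on $B(b,-):(B,\beta)\to(\Omega,\omega)$ for which, with a suitable lax $T$-morphism structure on $e$, the square is a left-tight pullback in $\mathrm{Alg}_{\mathrm{lx}}(T)$ (that is, $B(b,-)$ is a lax $T$-morphism, the one classifying $\partial_1$ in $\mathrm{Alg}_{\mathrm{lx}}(T)$); 2.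 with this structure, $B(b,-)$ is a pseudo $T$-morphism (its laxator is invertible) if and only if $B$ is $T$-cartesian at $b$. -/

import Mathlib

/-! Enhanced 2-categories, classifiers for discrete opfibrations, and algebras of enhanced 2-monads.

2-categories are strict bicategories, and `f ≫ g` is composition in diagrammatic order.  Equations
between 2-cells whose boundaries are equal 1-cells, but not syntactically the same ones, are written
with heterogeneous equality `≍`; wherever it occurs, the two sides have provably equal sources and
provably equal targets. -/

open CategoryTheory Bicategory

universe w v u

/-! ### Enhanced 2-categories and their limits -/

/-- The enhancement of a 2-category: a class of *tight* 1-cells that contains the identities and is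
closed under composition (a wide and locally full sub-2-category). -/
class Enhanced (K : Type u) [Bicategory.{w, v} K] where
  tight : ∀ {A B : K}, (A ⟶ B) → Prop
  tight_id : ∀ A : K, tight (𝟙 A)
  tight_comp : ∀ {A B C : K} (f : A ⟶ B) (g : B ⟶ C), tight f → tight g → tight (f ≫ g)

section Limits

variable {K : Type u} [Bicategory.{w, v} K] [Strict K]

/-- The square `p ≫ f = q ≫ g` is a strict 2-pullback. -/
structure IsTwoPullback {P A D C : K} (p : P ⟶ A) (q : P ⟶ D) (f : A ⟶ C) (g : D ⟶ C) :
    Prop where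
  comm : p ≫ f = q ≫ g
  lift : ∀ {Z : K} (x : Z ⟶ A) (y : Z ⟶ D), x ≫ f = y ≫ g →
    ∃! h : Z ⟶ P, h ≫ p = x ∧ h ≫ q = y
  lift₂ : ∀ {Z : K} (h k : Z ⟶ P) (θ : h ≫ p ⟶ k ≫ p) (ψ : h ≫ q ⟶ k ≫ q),
    θ ▷ f ≍ ψ ▷ g → ∃! χ : h ⟶ k, χ ▷ p = θ ∧ χ ▷ q = ψ

/-- `p : E ⟶ B` is a discrete opfibration: every 2-cell `φ : e ≫ p ⟶ b` has a unique lift to a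
2-cell `e ⟶ e'`. -/
def IsDiscreteOpfibration {E B : K} (p : E ⟶ B) : Prop :=
  ∀ {X : K} (e : X ⟶ E) (b : X ⟶ B) (φ : e ≫ p ⟶ b),
    ∃! l : (e' : X ⟶ E) × (e ⟶ e'), l.1 ≫ p = b ∧ l.2 ▷ p ≍ φ

/-- A comma object of `b : X ⟶ B` over the identity of `B`, that is, the universal 2-cell
`cell : dom ≫ b ⟶ cod` out of `b`.  Its vertex is `b / B`, and `cod` is the representable discrete
opfibration `∂₁ : b / B ⟶ B`. -/
structure RepComma {X B : K} (b : X ⟶ B) where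
  pt : K
  dom : pt ⟶ X
  cod : pt ⟶ B
  cell : dom ≫ b ⟶ cod
  lift : ∀ {Z : K} (x : Z ⟶ X) (y : Z ⟶ B) (ψ : x ≫ b ⟶ y),
    ∃! h : Z ⟶ pt, h ≫ dom = x ∧ h ≫ cod = y ∧ h ◁ cell ≍ ψ
  lift₂ : ∀ {Z : K} (h k : Z ⟶ pt) (θ : h ≫ dom ⟶ k ≫ dom) (ψ : h ≫ cod ⟶ k ≫ cod),
    θ ▷ b ≫ (α_ k dom b).hom ≫ k ◁ cell = (α_ h dom b).hom ≫ h ◁ cell ≫ ψ →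
    ∃! χ : h ⟶ k, χ ▷ dom = θ ∧ χ ▷ cod = ψ

/-- A split equivalence: `d` has a strict section `s`, and `d ≫ s` is isomorphic to the identity. -/
def IsSplitEquivalence {A B : K} (d : A ⟶ B) : Prop :=
  ∃ s : B ⟶ A, s ≫ d = 𝟙 B ∧ Nonempty (d ≫ s ≅ 𝟙 A)

variable [Enhanced K]

/-- A left-tight pullback: a strict 2-pullback whose left leg `p` is tight and detects
tightness. -/
structure IsLeftTightPullback {P A D C : K} (p : P ⟶ A) (q : P ⟶ D) (f : A ⟶ C) (g : D ⟶ C) :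
    Prop extends IsTwoPullback p q f g where
  tight_left : Enhanced.tight p
  detects : ∀ {Z : K} (h : Z ⟶ P), Enhanced.tight (h ≫ p) → Enhanced.tight h

def IsTightDiscreteOpfibration {E B : K} (p : E ⟶ B) : Prop :=
  Enhanced.tight p ∧ IsDiscreteOpfibration p

/-- A tight terminal object: `K(X, t)` is the terminal category for every `X`, and the unique
1-cells `X ⟶ t` are tight. -/
structure IsTightTerminal (t : K) : Prop where
  exists_tight : ∀ X : K, ∃ f : X ⟶ t, Enhanced.tight f
  hom_eq : ∀ {X : K} (f g : X ⟶ t), f = g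
  cell_eq : ∀ {X : K} {f g : X ⟶ t} (θ ψ : f ⟶ g), θ = ψ

variable (K) in
/-- A plumbus: an enhanced 2-category with a tight terminal object and with left-tight pullbacks of
tight discrete opfibrations along arbitrary 1-cells. -/
structure IsPlumbus : Prop where
  exists_terminal : ∃ t : K, IsTightTerminal t
  exists_pullback : ∀ {E B A : K} (p : E ⟶ B) (f : A ⟶ B), IsTightDiscreteOpfibration p →
    ∃ (P : K) (p' : P ⟶ A) (q : P ⟶ E), IsLeftTightPullback p' q f p

variable (K) in
/-- A pullback-ideal of tight discrete opfibrations, called *small*: a replete class of tight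
discrete opfibrations that is stable under left-tight pullback and contains the identity of a
terminal object. -/
structure PullbackIdeal where
  small : ∀ {E B : K}, (E ⟶ B) → Prop
  isTightDiscreteOpfibration : ∀ {E B : K} (p : E ⟶ B), small p → IsTightDiscreteOpfibration p
  pullback : ∀ {P A E B : K} (p' : P ⟶ A) (q : P ⟶ E) (f : A ⟶ B) (p : E ⟶ B),
    IsLeftTightPullback p' q f p → small p → small p'
  replete : ∀ {E E' B : K} (p : E ⟶ B) (p' : E' ⟶ B) (k : E ⟶ E') (l : E' ⟶ E),
    k ≫ l = 𝟙 E → l ≫ k = 𝟙 E' → k ≫ p' = p →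
    small p → IsTightDiscreteOpfibration p' → small p'
  id_terminal : ∀ t : K, IsTightTerminal t → small (𝟙 t)

/-- Let `p : E ⟶ B` and `p' : E' ⟶ B` be the pullbacks of `u` along `f, g : B ⟶ Ω`, with top sides
`e` and `e'`.  The functor `(-)^* u` sends the 2-cell `φ : f ⟶ g` to the unique `k : E ⟶ E'` over
`B` for which the lift of `p ◁ φ` along `u` starting at `e` ends at `k ≫ e'`.  This says that `k` is
that 1-cell. -/
def IsPullbackOfCell {Ωp Ω B E E' : K} (u : Ωp ⟶ Ω) {f g : B ⟶ Ω} (p : E ⟶ B) (e : E ⟶ Ωp)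
    (p' : E' ⟶ B) (e' : E' ⟶ Ωp) (φ : f ⟶ g) (k : E ⟶ E') : Prop :=
  k ≫ p' = p ∧ ∃ l : e ⟶ k ≫ e', l ▷ u ≍ p ◁ φ

/-- `u : Ωp ⟶ Ω` is a 2-classifier for small discrete opfibrations: it is small, and the functors
`(-)^* u` from `K(B, Ω)` to tight discrete opfibrations over `B` are fully faithful, with essential
image the small ones. -/
structure PullbackIdeal.IsTwoClassifier (S : PullbackIdeal K) {Ωp Ω : K} (u : Ωp ⟶ Ω) :
    Prop where
  small : S.small u
  classify : ∀ {E B : K} (p : E ⟶ B), S.small p →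
    ∃ (f : B ⟶ Ω) (e : E ⟶ Ωp), IsLeftTightPullback p e f u
  fullyFaithful : ∀ {B E E' : K} (f g : B ⟶ Ω) (p : E ⟶ B) (e : E ⟶ Ωp) (p' : E' ⟶ B)
    (e' : E' ⟶ Ωp), IsLeftTightPullback p e f u → IsLeftTightPullback p' e' g u →
    ∀ k : E ⟶ E', k ≫ p' = p → ∃! φ : f ⟶ g, IsPullbackOfCell u p e p' e' φ k

end Limits

/-! ### Auxiliary facts on equality of 2-cells up to equality of their boundaries -/

section Whiskering

variable {K : Type u} [Bicategory.{w, v} K]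

theorem whiskerLeft_congr_left {A B C : K} {f f' : A ⟶ B} {g h : B ⟶ C} (θ : g ⟶ h)
    (hf : f = f') :
    f ◁ θ = eqToHom (by rw [hf]) ≫ f' ◁ θ ≫ eqToHom (by rw [hf]) := by
  subst hf; simp

theorem whiskerRight_congr_right {A B C : K} {f g : A ⟶ B} {h h' : B ⟶ C} (θ : f ⟶ g)
    (hh : h = h') :
    θ ▷ h = eqToHom (by rw [hh]) ≫ θ ▷ h' ≫ eqToHom (by rw [hh]) := by
  subst hh; simp

variable [Strict K]

theorem comp_whiskerLeft_eqToHom {A B C D : K} (f : A ⟶ B) (g : B ⟶ C) {h k : C ⟶ D}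
    (θ : h ⟶ k) :
    (f ≫ g) ◁ θ = eqToHom (Strict.assoc f g h) ≫ f ◁ g ◁ θ ≫
      eqToHom (Strict.assoc f g k).symm := by
  simp [Strict.associator_eqToIso]

theorem whiskerRight_comp_eqToHom {A B C D : K} {f g : A ⟶ B} (θ : f ⟶ g) (h : B ⟶ C)
    (k : C ⟶ D) :
    θ ▷ (h ≫ k) = eqToHom (Strict.assoc f h k).symm ≫ θ ▷ h ▷ k ≫
      eqToHom (Strict.assoc g h k) := by
  simp [Strict.associator_eqToIso]

theorem whisker_assoc_eqToHom {A B C D : K} (f : A ⟶ B) {g h : B ⟶ C} (θ : g ⟶ h) (k : C ⟶ D) :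
    (f ◁ θ) ▷ k = eqToHom (Strict.assoc f g k) ≫ f ◁ θ ▷ k ≫
      eqToHom (Strict.assoc f h k).symm := by
  simp [Strict.associator_eqToIso]

theorem id_whiskerLeft_eqToHom {A B : K} {f g : A ⟶ B} (θ : f ⟶ g) :
    𝟙 A ◁ θ = eqToHom (Strict.id_comp f) ≫ θ ≫ eqToHom (Strict.id_comp g).symm := by
  simp [Strict.leftUnitor_eqToIso]

theorem whiskerRight_id_eqToHom {A B : K} {f g : A ⟶ B} (θ : f ⟶ g) :
    θ ▷ 𝟙 B = eqToHom (Strict.comp_id f) ≫ θ ≫ eqToHom (Strict.comp_id g).symm := by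
  simp [Strict.rightUnitor_eqToIso]

theorem StrictPseudofunctor.map₂_whiskerLeft' (T : StrictPseudofunctor K K) {A B C : K}
    (f : A ⟶ B) {g h : B ⟶ C} (θ : g ⟶ h) :
    T.map₂ (f ◁ θ) = eqToHom (T.map_comp f g) ≫ T.map f ◁ T.map₂ θ ≫
      eqToHom (T.map_comp f h).symm := by
  simp [T.mapComp_eq_eqToIso]

theorem StrictPseudofunctor.map₂_whiskerRight' (T : StrictPseudofunctor K K) {A B C : K}
    {f g : A ⟶ B} (θ : f ⟶ g) (h : B ⟶ C) :
    T.map₂ (θ ▷ h) = eqToHom (T.map_comp f h) ≫ T.map₂ θ ▷ T.map h ≫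
      eqToHom (T.map_comp g h).symm := by
  simp [T.mapComp_eq_eqToIso]

end Whiskering

/-! ### Enhanced 2-monads and their algebras -/

section Monads

variable (K : Type u) [Bicategory.{w, v} K] [Strict K] [Enhanced K]

/-- An enhanced 2-monad: a strict 2-functor `T` that preserves tightness, with 2-natural unit and
multiplication that have tight components and satisfy the monad laws. -/
structure EnhancedTwoMonad extends StrictPseudofunctor K K where
  map_tight : ∀ {A B : K} (f : A ⟶ B), Enhanced.tight f → Enhanced.tight (map f)
  i : ∀ A : K, A ⟶ obj A
  m : ∀ A : K, obj (obj A) ⟶ obj A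
  i_tight : ∀ A : K, Enhanced.tight (i A)
  m_tight : ∀ A : K, Enhanced.tight (m A)
  i_naturality : ∀ {A B : K} (f : A ⟶ B), i A ≫ map f = f ≫ i B
  m_naturality : ∀ {A B : K} (f : A ⟶ B), m A ≫ map f = map (map f) ≫ m B
  i_naturality₂ : ∀ {A B : K} {f g : A ⟶ B} (θ : f ⟶ g), i A ◁ map₂ θ ≍ θ ▷ i B
  m_naturality₂ : ∀ {A B : K} {f g : A ⟶ B} (θ : f ⟶ g),
    m A ◁ map₂ θ ≍ map₂ (map₂ θ) ▷ m B
  i_m : ∀ A : K, i (obj A) ≫ m A = 𝟙 (obj A)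
  map_i_m : ∀ A : K, map (i A) ≫ m A = 𝟙 (obj A)
  m_m : ∀ A : K, m (obj A) ≫ m A = map (m A) ≫ m A

end Monads

section Algebras

variable {K : Type u} [Bicategory.{w, v} K] [Strict K] [Enhanced K]

namespace EnhancedTwoMonad

/-- `a : T A ⟶ A` is a tight 1-cell that makes `A` a strict `T`-algebra. -/
structure IsAlgebra (T : EnhancedTwoMonad K) {A : K} (a : T.obj A ⟶ A) : Prop where
  tight : Enhanced.tight a
  unit : T.i A ≫ a = 𝟙 A
  assoc : T.m A ≫ a = T.map a ≫ a

/-- Objects of the enhanced 2-category `Alg_lx(T)`: strict `T`-algebras with tight structure map. -/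
structure AlgLx (T : EnhancedTwoMonad K) where
  carrier : K
  str : T.obj carrier ⟶ carrier
  isAlgebra : T.IsAlgebra str

variable {T : EnhancedTwoMonad K}

/-- A lax `T`-morphism: a (loose) 1-cell with a laxator satisfying the unit and multiplication
axioms. -/
@[ext]
structure LaxHom (A B : AlgLx T) where
  map : A.carrier ⟶ B.carrier
  lax : T.map map ≫ B.str ⟶ A.str ≫ map
  lax_unit : T.i A.carrier ◁ lax ≍ 𝟙 map
  lax_mult : T.m A.carrier ◁ lax ≍
    T.map₂ lax ▷ B.str ≫ eqToHom (by simp [T.map_comp]) ≫ T.map A.str ◁ lax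

/-- A colax `T`-morphism: a (loose) 1-cell with a colaxator satisfying the unit and multiplication
axioms. -/
structure ColaxHom (A B : AlgLx T) where
  map : A.carrier ⟶ B.carrier
  colax : A.str ≫ map ⟶ T.map map ≫ B.str
  colax_unit : T.i A.carrier ◁ colax ≍ 𝟙 map
  colax_mult : T.m A.carrier ◁ colax ≍
    T.map A.str ◁ colax ≫ eqToHom (by simp [T.map_comp]) ≫ T.map₂ colax ▷ B.str

/-- A lax `T`-morphism is pseudo when its laxator is invertible. -/
def LaxHom.IsPseudo {A B : AlgLx T} (f : LaxHom A B) : Prop := IsIso f.lax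

/-- A `T`-2-morphism of lax `T`-morphisms. -/
@[ext]
structure LaxHom.Cell {A B : AlgLx T} (f g : LaxHom A B) where
  cell : f.map ⟶ g.map
  comm : T.map₂ cell ▷ B.str ≫ g.lax = f.lax ≫ A.str ◁ cell

/-! #### The 2-category structure of `Alg_lx(T)` -/

instance (A B : AlgLx T) : Category (LaxHom A B) where
  Hom f g := LaxHom.Cell f g
  id f := ⟨𝟙 _, by simp⟩
  comp θ ψ := ⟨θ.cell ≫ ψ.cell, by
    rw [T.map₂_comp, comp_whiskerRight, Category.assoc, ψ.comm, ← Category.assoc, θ.comm,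
      Category.assoc, whiskerLeft_comp]⟩

@[simp] theorem LaxHom.id_cell {A B : AlgLx T} (f : LaxHom A B) :
    LaxHom.Cell.cell (𝟙 f) = 𝟙 f.map := rfl

@[simp] theorem LaxHom.comp_cell {A B : AlgLx T} {f g h : LaxHom A B} (θ : f ⟶ g) (ψ : g ⟶ h) :
    LaxHom.Cell.cell (θ ≫ ψ) = LaxHom.Cell.cell θ ≫ LaxHom.Cell.cell ψ := rfl

@[ext] theorem LaxHom.hom_ext {A B : AlgLx T} {f g : LaxHom A B} {θ ψ : f ⟶ g}
    (h : LaxHom.Cell.cell θ = LaxHom.Cell.cell ψ) : θ = ψ := LaxHom.Cell.ext h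

/-- A 1-cell that strictly commutes with the structure maps, as a lax `T`-morphism. -/
def LaxHom.ofStrict {A B : AlgLx T} (f : A.carrier ⟶ B.carrier)
    (hf : T.map f ≫ B.str = A.str ≫ f) : LaxHom A B where
  map := f
  lax := eqToHom hf
  lax_unit := by
    rw [whiskerLeft_eqToHom]
    refine (eqToHom_heq_id_cod _ _ _).trans ?_
    rw [← Strict.assoc, A.isAlgebra.unit, Strict.id_comp]
  lax_mult := by
    simp only [whiskerLeft_eqToHom, PrelaxFunctor.map₂_eqToHom, eqToHom_whiskerRight,
      eqToHom_trans]
    refine (eqToHom_heq_id_cod _ _ _).trans ((?_ : HEq _ _).trans (eqToHom_heq_id_cod _ _ _).symm)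
    rw [← Strict.assoc, A.isAlgebra.assoc, Strict.assoc]

def LaxHom.id (A : AlgLx T) : LaxHom A A :=
  LaxHom.ofStrict (𝟙 A.carrier) (by rw [T.map_id, Strict.id_comp, Strict.comp_id])

theorem LaxHom.lax_unit' {A B : AlgLx T} (f : LaxHom A B) :
    T.i A.carrier ◁ f.lax = eqToHom (by
      rw [← Strict.assoc, T.i_naturality, Strict.assoc, B.isAlgebra.unit, Strict.comp_id,
        ← Strict.assoc, A.isAlgebra.unit, Strict.id_comp]) := by
  apply eq_of_heq
  refine f.lax_unit.trans (HEq.trans ?_ (eqToHom_heq_id_cod _ _ _).symm)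
  rw [← Strict.assoc, A.isAlgebra.unit, Strict.id_comp]

theorem LaxHom.lax_mult' {A B : AlgLx T} (f : LaxHom A B) :
    T.m A.carrier ◁ f.lax = eqToHom (by
        rw [← Strict.assoc, T.m_naturality, T.map_comp, Strict.assoc, Strict.assoc,
          B.isAlgebra.assoc]) ≫
      (T.map₂ f.lax ▷ B.str ≫ eqToHom (by simp [T.map_comp]) ≫ T.map A.str ◁ f.lax) ≫
      eqToHom (by rw [← Strict.assoc, ← Strict.assoc, A.isAlgebra.assoc]) :=
  (conj_eqToHom_iff_heq' _ _ _ _).2 f.lax_mult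

/-- Composition of lax `T`-morphisms. -/
def LaxHom.comp {A B C : AlgLx T} (f : LaxHom A B) (g : LaxHom B C) : LaxHom A C where
  map := f.map ≫ g.map
  lax := eqToHom (by rw [T.map_comp, Strict.assoc]) ≫ T.map f.map ◁ g.lax ≫
    eqToHom (Strict.assoc _ _ _).symm ≫ f.lax ▷ g.map ≫ eqToHom (Strict.assoc _ _ _)
  lax_unit := by
    have h1 := whiskerLeft_congr_left g.lax (T.i_naturality f.map)
    rw [comp_whiskerLeft_eqToHom, comp_whiskerLeft_eqToHom, g.lax_unit'] at h1
    have h2 := whisker_assoc_eqToHom (T.i A.carrier) f.lax g.map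
    rw [f.lax_unit'] at h2
    simp only [whiskerLeft_eqToHom, eqToHom_whiskerRight, eqToHom_trans] at h1 h2
    rw [eqToHom_comp_iff, comp_eqToHom_iff] at h1
    rw [eq_comm, eqToHom_comp_iff, comp_eqToHom_iff] at h2
    simp only [whiskerLeft_comp, whiskerLeft_eqToHom, h1, h2, eqToHom_trans]
    refine (eqToHom_heq_id_cod _ _ _).trans ?_
    rw [← Strict.assoc, A.isAlgebra.unit, Strict.id_comp]
  lax_mult := by
    have h1 := whiskerLeft_congr_left g.lax (T.m_naturality f.map)
    rw [comp_whiskerLeft_eqToHom, comp_whiskerLeft_eqToHom, g.lax_mult'] at h1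
    rw [eqToHom_comp_iff, comp_eqToHom_iff] at h1
    have h2 := whisker_assoc_eqToHom (T.m A.carrier) f.lax g.map
    rw [f.lax_mult', eq_comm, eqToHom_comp_iff, comp_eqToHom_iff] at h2
    have h3 := whisker_exchange (T.map₂ f.lax) g.lax
    rw [whiskerLeft_congr_left g.lax (T.map_comp (T.map f.map) B.str),
      whiskerLeft_congr_left g.lax (T.map_comp A.str f.map)] at h3
    simp only [comp_whiskerLeft_eqToHom, whiskerRight_comp_eqToHom, Category.assoc,
      eqToHom_trans_assoc, eqToHom_trans] at h3
    rw [eqToHom_comp_iff] at h3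
    refine (conj_eqToHom_iff_heq' _ _ ?_ ?_).1 ?_
    · rw [← Strict.assoc, T.m_naturality]
      simp [T.map_comp, C.isAlgebra.assoc]
    · rw [← Strict.assoc (T.m A.carrier), A.isAlgebra.assoc, Strict.assoc]
    simp only [whiskerLeft_comp, comp_whiskerRight, h1, h2, whiskerLeft_eqToHom, T.map₂_comp,
      eqToHom_whiskerRight, PrelaxFunctor.map₂_eqToHom, whisker_assoc_eqToHom,
      StrictPseudofunctor.map₂_whiskerLeft', StrictPseudofunctor.map₂_whiskerRight',
      Category.assoc, eqToHom_trans, eqToHom_trans_assoc]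
    have h4 := congrArg (fun t => T.map (T.map f.map) ◁ T.map₂ g.lax ▷ C.str ≫
      eqToHom (by simp [T.map_comp]) ≫ t ≫ eqToHom (by simp [T.map_comp]) ≫
        T.map A.str ◁ f.lax ▷ g.map) h3
    simp only [Category.assoc, eqToHom_trans_assoc] at h4
    simp only [reassoc_of% h4]

def LaxHom.whiskerLeft {A B C : AlgLx T} (f : LaxHom A B) {g h : LaxHom B C} (θ : g ⟶ h) :
    f.comp g ⟶ f.comp h where
  cell := f.map ◁ LaxHom.Cell.cell θ
  comm := by
    have h1 := congrArg (fun t => T.map f.map ◁ t) (LaxHom.Cell.comm θ)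
    simp only [whiskerLeft_comp] at h1
    have h2 := whisker_exchange f.lax (LaxHom.Cell.cell θ)
    simp only [comp_whiskerLeft_eqToHom, Category.assoc] at h2
    rw [eqToHom_comp_iff] at h2
    simp only [LaxHom.comp, StrictPseudofunctor.map₂_whiskerLeft', comp_whiskerRight,
      eqToHom_whiskerRight, whisker_assoc_eqToHom, Category.assoc, eqToHom_trans_assoc,
      eqToHom_refl, Category.id_comp]
    rw [reassoc_of% h1]
    simp only [reassoc_of% h2, eqToHom_trans, eqToHom_refl, Category.comp_id]

def LaxHom.whiskerRight {A B C : AlgLx T} {f g : LaxHom A B} (θ : f ⟶ g) (h : LaxHom B C) :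
    f.comp h ⟶ g.comp h where
  cell := LaxHom.Cell.cell θ ▷ h.map
  comm := by
    have h1 := congrArg (fun t => t ▷ h.map) (LaxHom.Cell.comm θ)
    simp only [comp_whiskerRight, whisker_assoc_eqToHom] at h1
    have h2 := whisker_exchange (T.map₂ (LaxHom.Cell.cell θ)) h.lax
    simp only [whiskerRight_comp_eqToHom, Category.assoc] at h2
    rw [eq_comm, eqToHom_comp_iff] at h2
    have h3 := congrArg (fun t => t ≫ eqToHom (Strict.assoc A.str g.map h.map)) h1
    simp only [Category.assoc, eqToHom_trans, eqToHom_refl, Category.comp_id] at h3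
    simp only [LaxHom.comp, StrictPseudofunctor.map₂_whiskerRight', comp_whiskerRight,
      eqToHom_whiskerRight, Category.assoc, eqToHom_trans_assoc, reassoc_of% h2,
      eqToHom_refl, Category.id_comp, h3]

@[simp] theorem LaxHom.whiskerLeft_cell {A B C : AlgLx T} (f : LaxHom A B) {g h : LaxHom B C}
    (θ : g ⟶ h) :
    LaxHom.Cell.cell (LaxHom.whiskerLeft f θ) = f.map ◁ LaxHom.Cell.cell θ := rfl

@[simp] theorem LaxHom.whiskerRight_cell {A B C : AlgLx T} {f g : LaxHom A B} (θ : f ⟶ g)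
    (h : LaxHom B C) :
    LaxHom.Cell.cell (LaxHom.whiskerRight θ h) = LaxHom.Cell.cell θ ▷ h.map := rfl

theorem LaxHom.ext_eqToHom {A B : AlgLx T} {f g : LaxHom A B} (h : f.map = g.map)
    (hl : f.lax = eqToHom (by rw [h]) ≫ g.lax ≫ eqToHom (by rw [h])) : f = g := by
  cases f; cases g; cases h
  simp only [eqToHom_refl, Category.id_comp, Category.comp_id] at hl
  cases hl; rfl

theorem LaxHom.id_comp' {A B : AlgLx T} (f : LaxHom A B) : (LaxHom.id A).comp f = f := by
  refine LaxHom.ext_eqToHom (Strict.id_comp _) ?_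
  simp only [LaxHom.comp, LaxHom.id, LaxHom.ofStrict,
    whiskerLeft_congr_left f.lax (T.map_id A.carrier), id_whiskerLeft_eqToHom,
    eqToHom_whiskerRight, Category.assoc, eqToHom_trans, eqToHom_trans_assoc]

theorem LaxHom.comp_id' {A B : AlgLx T} (f : LaxHom A B) : f.comp (LaxHom.id B) = f := by
  refine LaxHom.ext_eqToHom (Strict.comp_id _) ?_
  simp only [LaxHom.comp, LaxHom.id, LaxHom.ofStrict, whiskerRight_id_eqToHom,
    whiskerLeft_eqToHom, Category.assoc, eqToHom_trans, eqToHom_trans_assoc]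

theorem LaxHom.assoc' {A B C D : AlgLx T} (f : LaxHom A B) (g : LaxHom B C) (h : LaxHom C D) :
    (f.comp g).comp h = f.comp (g.comp h) := by
  refine LaxHom.ext (Strict.assoc _ _ _) ?_
  simp only [LaxHom.comp, whiskerLeft_congr_left h.lax (T.map_comp f.map g.map),
    comp_whiskerLeft_eqToHom, whiskerRight_comp_eqToHom, whisker_assoc_eqToHom,
    comp_whiskerRight, whiskerLeft_comp, whiskerLeft_eqToHom, eqToHom_whiskerRight,
    Category.assoc, eqToHom_trans, eqToHom_trans_assoc]
  refine (conj_eqToHom_iff_heq' _ _ ?_ ?_).1 ?_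
  · simp [T.map_comp]
  · simp
  simp only [Category.assoc, eqToHom_trans, eqToHom_trans_assoc]

@[simp] theorem LaxHom.eqToHom_cell {A B : AlgLx T} {f g : LaxHom A B} (h : f = g) :
    LaxHom.Cell.cell (eqToHom h) = eqToHom (congrArg LaxHom.map h) := by
  subst h; rfl

instance : Bicategory (AlgLx T) where
  Hom A B := LaxHom A B
  id A := LaxHom.id A
  comp f g := LaxHom.comp f g
  whiskerLeft f _ _ θ := LaxHom.whiskerLeft f θ
  whiskerRight θ h := LaxHom.whiskerRight θ h
  associator f g h := eqToIso (LaxHom.assoc' f g h)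
  leftUnitor f := eqToIso (LaxHom.id_comp' f)
  rightUnitor f := eqToIso (LaxHom.comp_id' f)
  whiskerLeft_id f g := by
    ext; exact whiskerLeft_id f.map g.map
  whiskerLeft_comp f _ _ _ θ ψ := by
    ext; exact whiskerLeft_comp f.map θ.cell ψ.cell
  id_whiskerLeft θ := by
    ext; simp only [LaxHom.comp_cell, eqToIso.hom, eqToIso.inv, LaxHom.eqToHom_cell]
    exact id_whiskerLeft_eqToHom θ.cell
  comp_whiskerLeft f g _ _ θ := by
    ext; simp only [LaxHom.comp_cell, eqToIso.hom, eqToIso.inv, LaxHom.eqToHom_cell]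
    exact comp_whiskerLeft_eqToHom f.map g.map θ.cell
  id_whiskerRight f g := by
    ext; exact id_whiskerRight f.map g.map
  comp_whiskerRight θ ψ f := by
    ext; exact comp_whiskerRight θ.cell ψ.cell f.map
  whiskerRight_id θ := by
    ext; simp only [LaxHom.comp_cell, eqToIso.hom, eqToIso.inv, LaxHom.eqToHom_cell]
    exact whiskerRight_id_eqToHom θ.cell
  whiskerRight_comp θ f g := by
    ext; simp only [LaxHom.comp_cell, eqToIso.hom, eqToIso.inv, LaxHom.eqToHom_cell]
    exact whiskerRight_comp_eqToHom θ.cell f.map g.map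
  whisker_assoc f _ _ θ h := by
    ext; simp only [LaxHom.comp_cell, eqToIso.hom, eqToIso.inv, LaxHom.eqToHom_cell]
    exact whisker_assoc_eqToHom f.map θ.cell h.map
  whisker_exchange θ ψ := by
    ext; exact whisker_exchange θ.cell ψ.cell
  pentagon f g h k := by
    ext
    have := pentagon f.map g.map h.map k.map
    simp only [Strict.associator_eqToIso, eqToIso.hom] at this
    simpa only [LaxHom.comp_cell, eqToIso.hom, LaxHom.eqToHom_cell, LaxHom.whiskerLeft_cell,
      LaxHom.whiskerRight_cell] using! this
  triangle f g := by
    ext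
    have := triangle f.map g.map
    simp only [Strict.associator_eqToIso, Strict.leftUnitor_eqToIso, Strict.rightUnitor_eqToIso,
      eqToIso.hom] at this
    simpa only [LaxHom.comp_cell, eqToIso.hom, LaxHom.eqToHom_cell, LaxHom.whiskerLeft_cell,
      LaxHom.whiskerRight_cell] using! this

instance : Strict (AlgLx T) where
  id_comp := LaxHom.id_comp'
  comp_id := LaxHom.comp_id'
  assoc := LaxHom.assoc'
  leftUnitor_eqToIso _ := rfl
  rightUnitor_eqToIso _ := rfl
  associator_eqToIso _ _ _ := rfl

/-- The tight 1-cells of `Alg_lx(T)` are the strict `T`-morphisms whose underlying 1-cell is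
tight. -/
instance : Enhanced (AlgLx T) where
  tight {A B} f := Enhanced.tight (LaxHom.map f) ∧
    ∃ h : T.map (LaxHom.map f) ≫ B.str = A.str ≫ LaxHom.map f, LaxHom.lax f = eqToHom h
  tight_id A := ⟨Enhanced.tight_id A.carrier, by
    change T.map (𝟙 A.carrier) ≫ _ = _ ≫ 𝟙 A.carrier
    rw [T.map_id, Strict.id_comp, Strict.comp_id], rfl⟩
  tight_comp f g hf hg := by
    obtain ⟨hf, ef, hf'⟩ := hf
    obtain ⟨hg, eg, hg'⟩ := hg
    refine ⟨Enhanced.tight_comp _ _ hf hg, ?_, ?_⟩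
    · change T.map (f.map ≫ g.map) ≫ _ = _ ≫ f.map ≫ g.map
      rw [T.map_comp, Strict.assoc, eg, ← Strict.assoc, ef, Strict.assoc]
    · change LaxHom.lax (LaxHom.comp f g) = _
      simp only [LaxHom.comp, hf', hg', whiskerLeft_eqToHom, eqToHom_whiskerRight, eqToHom_trans]
      rfl

/-! #### Cartesian morphisms and the lifting hypotheses -/

variable (T) in
/-- A strict morphism `f` from `(A, a)` to `(B, b)` is `T`-cartesian: its defect, the comparison `d`
from `T A` to the pullback of `f` and `b`, is a split equivalence. -/
def IsCartesian {A B : K} (a : T.obj A ⟶ A) (b : T.obj B ⟶ B) (f : A ⟶ B) : Prop :=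
  T.map f ≫ b = a ≫ f ∧
    ∃ (P : K) (p : P ⟶ A) (q : P ⟶ T.obj B) (d : T.obj A ⟶ P),
      IsTwoPullback p q f b ∧ d ≫ p = a ∧ d ≫ q = T.map f ∧ IsSplitEquivalence d

section Comma

variable {X B : AlgLx T} (b : ColaxHom X B) (C : RepComma b.map)

/-- The pasting of `T` of the comma cell with the colaxator of `b`. -/
def ColaxHom.commaCell :
    (T.map C.dom ≫ X.str) ≫ b.map ⟶ T.map C.cod ≫ B.str :=
  (α_ _ _ _).hom ≫ T.map C.dom ◁ b.colax ≫
    eqToHom (by rw [← Strict.assoc, ← T.map_comp]) ≫ T.map₂ C.cell ▷ B.str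

/-- The structure map `T (b / B) ⟶ b / B` induced by the colaxator of `b`, that is, by the creation
of the comma object `b / B` in the 2-category of algebras and colax morphisms. -/
noncomputable def ColaxHom.commaStr : T.obj C.pt ⟶ C.pt :=
  (C.lift (T.map C.dom ≫ X.str) (T.map C.cod ≫ B.str) (b.commaCell C)).choose

theorem ColaxHom.commaStr_spec : b.commaStr C ≫ C.dom = T.map C.dom ≫ X.str ∧
    b.commaStr C ≫ C.cod = T.map C.cod ≫ B.str ∧ b.commaStr C ◁ C.cell ≍ b.commaCell C :=
  (C.lift (T.map C.dom ≫ X.str) (T.map C.cod ≫ B.str) (b.commaCell C)).choose_spec.1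

/-- The algebra `B` is `T`-cartesian at the colax morphism `b`: the representable discrete
opfibration `∂₁ : b / B ⟶ B` is a `T`-cartesian morphism. -/
def ColaxHom.IsCartesianAt : Prop :=
  ∃ C : RepComma b.map, T.IsCartesian (b.commaStr C) B.str C.cod

end Comma

/-- The hypotheses for lifting the 2-classifier `u` to `T`-algebras: `T u` is small and is
classified by a tight 1-cell `ω` (with top side `ωp`) that makes `Ω` a strict `T`-algebra, `T`
preserves pullbacks of `u`, and the unit and multiplication of `T` are cartesian at `u`. -/
structure LiftsClassifier (T : EnhancedTwoMonad K) (S : PullbackIdeal K) {Ωp Ω : K} (u : Ωp ⟶ Ω)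
    (ωp : T.obj Ωp ⟶ Ωp) (ω : T.obj Ω ⟶ Ω) : Prop where
  small : S.small (T.map u)
  map_pullback : ∀ {E B : K} (p : E ⟶ B) (e : E ⟶ Ωp) (f : B ⟶ Ω),
    IsLeftTightPullback p e f u → IsTwoPullback (T.map p) (T.map e) (T.map f) (T.map u)
  i_cartesian : IsTwoPullback u (T.i Ωp) (T.i Ω) (T.map u)
  m_cartesian : IsTwoPullback (T.map (T.map u)) (T.m Ωp) (T.m Ω) (T.map u)
  classifies : IsLeftTightPullback (T.map u) ωp ω u
  isAlgebra : T.IsAlgebra ω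

end EnhancedTwoMonad

end Algebras

/-!
A left-tight pullback square of `u` is initial among the commutative squares from its left leg to
`u`: this is what the full faithfulness of `(-)^* u` amounts to. If `p` is the pullback of `u` along
`f`, with top side `e`, then `T` of this square pasted with the square of `ω` is a pullback of `u`
as well, so exactly one compatible pair of 2-cells goes from `(T f ≫ ω, T e ≫ ωp)` to
`(β ≫ f, α ≫ e)`, for algebra structures `α` and `β` that make `p` strict. These are the laxators of
`f` and `e`, and the axioms they must satisfy are equalities between 2-cells out of initial squares.
Under `(-)^* u` the laxator of `f` becomes the comparison of `T p` with the pullback of `p` along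
`β`. It is therefore invertible if and only if that comparison is, and for discrete opfibrations the
latter only requires a split equivalence.

The algebra laws for `ωp` hold over `Ω`. They lift to `Ωp` because the point `s` of `Ωp` that
classifies the identity of the terminal object admits a 2-cell `π ≫ s ⟶ 𝟙 Ωp`, so that 1-cells out
of `Ωp` which agree at `s` and after composition with `u` are equal.
-/

/-! ### Bundled 2-cells -/

/-- A 2-cell bundled with its boundary. Equality of bundled 2-cells stands in for heterogeneous
equality, so that the strict laws for 1-cells can be used by rewriting. -/
structure TwoCell {K : Type u} [Bicategory.{w, v} K] (A B : K) where of ::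
  {src : A ⟶ B}
  {tgt : A ⟶ B}
  cell : src ⟶ tgt

/-- Left whiskering of a bundled 2-cell, written `f ◀ c`. -/
def TwoCell.whiskerLeft {K : Type u} [Bicategory.{w, v} K] {A B C : K} (f : A ⟶ B)
    (c : TwoCell B C) : TwoCell A C :=
  of (f ◁ c.cell)

/-- Right whiskering of a bundled 2-cell, written `c ▶ g`. -/
def TwoCell.whiskerRight {K : Type u} [Bicategory.{w, v} K] {A B C : K} (c : TwoCell A B)
    (g : B ⟶ C) : TwoCell A C :=
  of (c.cell ▷ g)

local infixr:81 " ◀ " => TwoCell.whiskerLeft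

local infixl:81 " ▶ " => TwoCell.whiskerRight

section BundledCells

variable {K : Type u} [Bicategory.{w, v} K]

namespace TwoCell

variable {A B C D : K}

/-- The image of a bundled 2-cell under a strict 2-functor. -/
def map (T : StrictPseudofunctor K K) (c : TwoCell A B) : TwoCell (T.obj A) (T.obj B) :=
  of (T.map₂ c.cell)

/-- `IsVComp c d e` says that `c` and `d` are composable and that `e` is their vertical composite.
It is a relation because bundled 2-cells compose only partially. -/
inductive IsVComp : TwoCell A B → TwoCell A B → TwoCell A B → Prop
  | of_comp {f g h : A ⟶ B} (θ : f ⟶ g) (ψ : g ⟶ h) : IsVComp (of θ) (of ψ) (of (θ ≫ ψ))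

theorem of_injective {f g : A ⟶ B} {θ ψ : f ⟶ g} (h : of θ = of ψ) : θ = ψ := by
  simpa only [of.injEq, heq_eq_eq, true_and] using h

theorem of_eq_of_heq {f g f' g' : A ⟶ B} {θ : f ⟶ g} {ψ : f' ⟶ g'} (hf : f = f') (hg : g = g')
    (h : θ ≍ ψ) : of θ = of ψ := by
  subst hf hg h; rfl

theorem heq_of_of_eq {f g f' g' : A ⟶ B} {θ : f ⟶ g} {ψ : f' ⟶ g'} (h : of θ = of ψ) : θ ≍ ψ := by
  cases h; rfl

theorem of_eqToHom {f g : A ⟶ B} (h : f = g) : of (eqToHom h) = of (𝟙 f) := by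
  subst h; rfl

theorem of_eqToHom_comp {f g h : A ⟶ B} (e : f = g) (θ : g ⟶ h) : of (eqToHom e ≫ θ) = of θ := by
  subst e; simp

theorem of_comp_eqToHom {f g h : A ⟶ B} (θ : f ⟶ g) (e : g = h) : of (θ ≫ eqToHom e) = of θ := by
  subst e; simp

@[simp] theorem whiskerLeft_src (f : A ⟶ B) (c : TwoCell B C) : (f ◀ c).src = f ≫ c.src := rfl
@[simp] theorem whiskerLeft_tgt (f : A ⟶ B) (c : TwoCell B C) : (f ◀ c).tgt = f ≫ c.tgt := rfl
@[simp] theorem whiskerRight_src (c : TwoCell A B) (g : B ⟶ C) : (c ▶ g).src = c.src ≫ g := rfl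
@[simp] theorem whiskerRight_tgt (c : TwoCell A B) (g : B ⟶ C) : (c ▶ g).tgt = c.tgt ≫ g := rfl

section Map

variable (T : StrictPseudofunctor K K)

@[simp] theorem map_src (c : TwoCell A B) : (c.map T).src = T.map c.src := rfl
@[simp] theorem map_tgt (c : TwoCell A B) : (c.map T).tgt = T.map c.tgt := rfl

end Map

@[simp] theorem whiskerLeft_of_id (f : A ⟶ B) (g : B ⟶ C) : f ◀ of (𝟙 g) = of (𝟙 (f ≫ g)) :=
  congrArg of (whiskerLeft_id f g)

@[simp] theorem whiskerRight_of_id (f : A ⟶ B) (g : B ⟶ C) : of (𝟙 f) ▶ g = of (𝟙 (f ≫ g)) :=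
  congrArg of (id_whiskerRight f g)

namespace IsVComp

variable {c c' d d' e e' : TwoCell A B}

theorem of_comp_eqToHom_comp {f g g' h : A ⟶ B} (θ : f ⟶ g) (eq : g = g') (ψ : g' ⟶ h) :
    IsVComp (of θ) (of ψ) (of (θ ≫ eqToHom eq ≫ ψ)) := by
  subst eq
  simpa only [eqToHom_refl, Category.id_comp] using of_comp θ ψ

theorem exists_of_tgt_eq_src (h : c.tgt = d.src) : ∃ e, IsVComp c d e := by
  obtain ⟨θ⟩ := c
  obtain ⟨ψ⟩ := d
  cases h
  exact ⟨_, of_comp θ ψ⟩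

theorem src_eq (h : IsVComp c d e) : e.src = c.src := by cases h; rfl

theorem tgt_eq (h : IsVComp c d e) : e.tgt = d.tgt := by cases h; rfl

theorem unique (h : IsVComp c d e) (h' : IsVComp c d e') : e = e' := by
  cases h; cases h'; rfl

theorem assoc {x y z xy yz xyz : TwoCell A B} (hxy : IsVComp x y xy) (hyz : IsVComp y z yz)
    (h : IsVComp xy z xyz) : IsVComp x yz xyz := by
  cases hxy with | of_comp θ ψ =>
  cases hyz with | of_comp _ χ =>
  cases h
  rw [Category.assoc]
  exact of_comp θ (ψ ≫ χ)

theorem eq_right {f : A ⟶ B} (h : IsVComp (of (𝟙 f)) d e) : e = d := by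
  cases h; rw [Category.id_comp]

theorem eq_left {f : A ⟶ B} (h : IsVComp c (of (𝟙 f)) e) : e = c := by
  cases h; rw [Category.comp_id]

protected theorem whiskerLeft (h : IsVComp c d e) {Z : K} (f : Z ⟶ A) :
    IsVComp (f ◀ c) (f ◀ d) (f ◀ e) := by
  cases h with | of_comp θ ψ =>
  simpa only [TwoCell.whiskerLeft, whiskerLeft_comp] using of_comp (f ◁ θ) (f ◁ ψ)

protected theorem whiskerRight (h : IsVComp c d e) {Z : K} (g : B ⟶ Z) :
    IsVComp (c ▶ g) (d ▶ g) (e ▶ g) := by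
  cases h with | of_comp θ ψ =>
  simpa only [TwoCell.whiskerRight, comp_whiskerRight] using of_comp (θ ▷ g) (ψ ▷ g)

protected theorem map (h : IsVComp c d e) (T : StrictPseudofunctor K K) :
    IsVComp (c.map T) (d.map T) (e.map T) := by
  cases h with | of_comp θ ψ =>
  simpa only [TwoCell.map, T.map₂_comp] using of_comp (T.map₂ θ) (T.map₂ ψ)

end IsVComp

variable [Strict K]

theorem whiskerLeft_whiskerLeft (f : A ⟶ B) (g : B ⟶ C) (c : TwoCell C D) :
    f ◀ g ◀ c = (f ≫ g) ◀ c := by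
  simp only [whiskerLeft, comp_whiskerLeft_eqToHom, of_eqToHom_comp, of_comp_eqToHom]

theorem whiskerRight_whiskerRight (c : TwoCell A B) (g : B ⟶ C) (h : C ⟶ D) :
    c ▶ g ▶ h = c ▶ (g ≫ h) := by
  simp only [whiskerRight, whiskerRight_comp_eqToHom, of_eqToHom_comp, of_comp_eqToHom]

theorem whiskerLeft_whiskerRight (f : A ⟶ B) (c : TwoCell B C) (h : C ⟶ D) :
    (f ◀ c) ▶ h = f ◀ (c ▶ h) := by
  simp only [whiskerLeft, whiskerRight, whisker_assoc_eqToHom, of_eqToHom_comp, of_comp_eqToHom]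

@[simp] protected theorem id_whiskerLeft (c : TwoCell A B) : 𝟙 A ◀ c = c := by
  simp only [whiskerLeft, id_whiskerLeft_eqToHom, of_eqToHom_comp, of_comp_eqToHom]

@[simp] protected theorem whiskerRight_id (c : TwoCell A B) : c ▶ 𝟙 B = c := by
  simp only [whiskerRight, whiskerRight_id_eqToHom, of_eqToHom_comp, of_comp_eqToHom]

theorem map_whiskerLeft (T : StrictPseudofunctor K K) (f : A ⟶ B) (c : TwoCell B C) :
    (f ◀ c).map T = T.map f ◀ c.map T := by
  simp only [whiskerLeft, map, _root_.StrictPseudofunctor.map₂_whiskerLeft', of_eqToHom_comp,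
    of_comp_eqToHom]

theorem map_whiskerRight (T : StrictPseudofunctor K K) (c : TwoCell A B) (g : B ⟶ C) :
    (c ▶ g).map T = c.map T ▶ T.map g := by
  simp only [whiskerRight, map, _root_.StrictPseudofunctor.map₂_whiskerRight', of_eqToHom_comp,
    of_comp_eqToHom]

end TwoCell

end BundledCells

/-! ### Discrete opfibrations and pullbacks -/

section OpfibrationsAndPullbacks

variable {K : Type u} [Bicategory.{w, v} K] [Strict K]

open TwoCell

section DiscreteOpfibration

variable {E B X : K} {p : E ⟶ B}

theorem isDiscreteOpfibration_of_cells
    (exists_lift : ∀ {X : K} (e : X ⟶ E) (c : TwoCell X B), c.src = e ≫ p →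
      ∃ l : TwoCell X E, l.src = e ∧ l ▶ p = c)
    (cell_ext : ∀ {X : K} (l l' : TwoCell X E), l.src = l'.src → l ▶ p = l' ▶ p → l = l') :
    IsDiscreteOpfibration p := by
  intro X e b φ
  obtain ⟨@⟨_, e', l⟩, rfl, hl⟩ := exists_lift e (of φ) rfl
  refine ⟨⟨e', l⟩, ⟨congrArg tgt hl, heq_of_of_eq hl⟩, ?_⟩
  rintro ⟨e'', l''⟩ ⟨rfl, hl''⟩
  cases cell_ext (of l'') (of l) rfl ((of_eq_of_heq rfl rfl hl'').trans hl.symm)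
  rfl

namespace IsDiscreteOpfibration

theorem exists_lift (hp : IsDiscreteOpfibration p) (e : X ⟶ E) (c : TwoCell X B)
    (h : c.src = e ≫ p) : ∃ l : TwoCell X E, l.src = e ∧ l ▶ p = c := by
  obtain @⟨_, b, φ⟩ := c
  cases h
  obtain ⟨⟨e', l⟩, ⟨he, hl⟩, -⟩ := hp e b φ
  exact ⟨of l, rfl, of_eq_of_heq rfl he hl⟩

theorem cell_ext (hp : IsDiscreteOpfibration p) {l l' : TwoCell X E} (hsrc : l.src = l'.src)
    (h : l ▶ p = l' ▶ p) : l = l' := by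
  obtain @⟨e, a, l⟩ := l
  obtain @⟨_, a', l'⟩ := l'
  cases hsrc
  cases (hp e _ (l ▷ p)).unique (y₁ := ⟨a, l⟩) (y₂ := ⟨a', l'⟩) ⟨rfl, HEq.rfl⟩
    ⟨(congrArg tgt h).symm, (heq_of_of_eq h).symm⟩
  rfl

theorem isVComp_of_whiskerRight (hp : IsDiscreteOpfibration p) {c d e : TwoCell X E}
    (hsrc : e.src = c.src) (hcd : c.tgt = d.src) (h : IsVComp (c ▶ p) (d ▶ p) (e ▶ p)) :
    IsVComp c d e := by
  obtain ⟨e', he'⟩ := IsVComp.exists_of_tgt_eq_src hcd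
  rwa [hp.cell_ext (hsrc.trans he'.src_eq.symm) (h.unique (he'.whiskerRight p))]

/-- Both whiskerings of `c` lift the same 2-cell, starting at `π ≫ s ≫ a = π ≫ s ≫ a'`. -/
theorem hom_ext_of_point (hp : IsDiscreteOpfibration p) {Y t : K} {a a' : Y ⟶ E} {π : Y ⟶ t}
    {s : t ⟶ Y} {c : TwoCell Y Y} (hsrc : c.src = π ≫ s) (htgt : c.tgt = 𝟙 Y)
    (h : a ≫ p = a' ≫ p) (hs : s ≫ a = s ≫ a') : a = a' := by
  have hc : c ▶ a = c ▶ a' :=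
    hp.cell_ext (by simp [hsrc, hs]) (by simp only [whiskerRight_whiskerRight, h])
  simpa [htgt] using congrArg tgt hc

end IsDiscreteOpfibration

end DiscreteOpfibration

section Pullback

variable {P A D C : K} {p : P ⟶ A} {q : P ⟶ D} {f : A ⟶ C} {g : D ⟶ C}

theorem isTwoPullback_of_cells (comm : p ≫ f = q ≫ g)
    (exists_cell : ∀ {Z : K} (c : TwoCell Z A) (d : TwoCell Z D), c ▶ f = d ▶ g →
      ∃ χ : TwoCell Z P, χ ▶ p = c ∧ χ ▶ q = d)
    (cell_ext : ∀ {Z : K} (χ χ' : TwoCell Z P), χ ▶ p = χ' ▶ p → χ ▶ q = χ' ▶ q → χ = χ') :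
    IsTwoPullback p q f g := by
  have hom_ext {Z : K} {k l : Z ⟶ P} (hp : k ≫ p = l ≫ p) (hq : k ≫ q = l ≫ q) : k = l :=
    congrArg src (cell_ext (of (𝟙 k)) (of (𝟙 l))
      (by rw [whiskerRight_of_id, hp, whiskerRight_of_id])
      (by rw [whiskerRight_of_id, hq, whiskerRight_of_id]))
  refine ⟨comm, fun {Z} x y hxy => ?_, fun {Z} k l θ ψ hθψ => ?_⟩
  · obtain ⟨χ, hp, hq⟩ := exists_cell (of (𝟙 x)) (of (𝟙 y))
      (by rw [whiskerRight_of_id, hxy, whiskerRight_of_id])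
    have hp' : χ.src ≫ p = x := congrArg src hp
    have hq' : χ.src ≫ q = y := congrArg src hq
    exact ⟨χ.src, ⟨hp', hq'⟩, fun k hk => hom_ext (hk.1.trans hp'.symm) (hk.2.trans hq'.symm)⟩
  · have comm' (m : Z ⟶ P) : (m ≫ p) ≫ f = (m ≫ q) ≫ g := by simp [comm]
    obtain ⟨@⟨a, b, χ⟩, hp, hq⟩ :=
      exists_cell (of θ) (of ψ) (of_eq_of_heq (comm' k) (comm' l) hθψ)
    obtain rfl : a = k := hom_ext (congrArg src hp) (congrArg src hq)
    obtain rfl : b = l := hom_ext (congrArg tgt hp) (congrArg tgt hq)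
    refine ⟨χ, ⟨of_injective hp, of_injective hq⟩, fun χ' hχ' => of_injective (cell_ext _ _ ?_ ?_)⟩
    · exact (congrArg of hχ'.1).trans hp.symm
    · exact (congrArg of hχ'.2).trans hq.symm

/-- The 2-dimensional universal property follows from the 1-dimensional one because 2-cells into
`P` are determined by their sources and their images along `p`. -/
theorem isTwoPullback_of_isDiscreteOpfibration (hp : IsDiscreteOpfibration p)
    (hg : IsDiscreteOpfibration g) (comm : p ≫ f = q ≫ g)
    (exists_hom : ∀ {Z : K} (x : Z ⟶ A) (y : Z ⟶ D), x ≫ f = y ≫ g →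
      ∃ k : Z ⟶ P, k ≫ p = x ∧ k ≫ q = y)
    (hom_ext : ∀ {Z : K} {k l : Z ⟶ P}, k ≫ p = l ≫ p → k ≫ q = l ≫ q → k = l) :
    IsTwoPullback p q f g := by
  refine isTwoPullback_of_cells comm (fun c d hcd => ?_) fun χ χ' hχp hχq => ?_
  · obtain ⟨k, hkp, hkq⟩ := exists_hom c.src d.src (congrArg src hcd)
    obtain ⟨χ, rfl, hχ⟩ := hp.exists_lift k c hkp.symm
    refine ⟨χ, hχ, hg.cell_ext hkq ?_⟩
    rw [← hcd, ← hχ, whiskerRight_whiskerRight, whiskerRight_whiskerRight, comm]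
  · exact hp.cell_ext (hom_ext (congrArg src hχp) (congrArg src hχq)) hχp

namespace IsTwoPullback

theorem exists_hom (h : IsTwoPullback p q f g) {Z : K} (x : Z ⟶ A) (y : Z ⟶ D)
    (hxy : x ≫ f = y ≫ g) : ∃ k : Z ⟶ P, k ≫ p = x ∧ k ≫ q = y :=
  (h.lift x y hxy).exists

theorem hom_ext (h : IsTwoPullback p q f g) {Z : K} {k l : Z ⟶ P} (hp : k ≫ p = l ≫ p)
    (hq : k ≫ q = l ≫ q) : k = l :=
  (h.lift (l ≫ p) (l ≫ q) (by simp [h.comm])).unique ⟨hp, hq⟩ ⟨rfl, rfl⟩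

theorem exists_cell (h : IsTwoPullback p q f g) {Z : K} (c : TwoCell Z A) (d : TwoCell Z D)
    (hcd : c ▶ f = d ▶ g) : ∃ χ : TwoCell Z P, χ ▶ p = c ∧ χ ▶ q = d := by
  obtain @⟨a, b, c⟩ := c
  obtain @⟨a', b', d⟩ := d
  obtain ⟨k, rfl, rfl⟩ := h.exists_hom a a' (congrArg src hcd)
  obtain ⟨l, rfl, rfl⟩ := h.exists_hom b b' (congrArg tgt hcd)
  obtain ⟨χ, ⟨rfl, rfl⟩, -⟩ := h.lift₂ k l c d (heq_of_of_eq hcd)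
  exact ⟨of χ, rfl, rfl⟩

theorem cell_ext (h : IsTwoPullback p q f g) {Z : K} {χ χ' : TwoCell Z P} (hp : χ ▶ p = χ' ▶ p)
    (hq : χ ▶ q = χ' ▶ q) : χ = χ' := by
  obtain @⟨a, b, χ⟩ := χ
  obtain @⟨a', b', χ'⟩ := χ'
  obtain rfl : a = a' := h.hom_ext (congrArg src hp) (congrArg src hq)
  obtain rfl : b = b' := h.hom_ext (congrArg tgt hp) (congrArg tgt hq)
  have hχ : (of χ ▶ p) ▶ f = (of χ ▶ q) ▶ g := by
    rw [whiskerRight_whiskerRight, whiskerRight_whiskerRight, h.comm]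
  exact congrArg of ((h.lift₂ a b (χ ▷ p) (χ ▷ q) (heq_of_of_eq hχ)).unique ⟨rfl, rfl⟩
    ⟨(of_injective hp).symm, (of_injective hq).symm⟩)

theorem flip (h : IsTwoPullback p q f g) : IsTwoPullback q p g f :=
  isTwoPullback_of_cells h.comm.symm
    (fun c d hcd => (h.exists_cell d c hcd.symm).imp fun _ hχ => hχ.symm)
    fun _ _ hq hp => h.cell_ext hp hq

theorem paste (h : IsTwoPullback p q f g) {E F : K} {r : D ⟶ E} {a : C ⟶ F} {k : E ⟶ F}
    (h' : IsTwoPullback g r a k) : IsTwoPullback p (q ≫ r) (f ≫ a) k := by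
  refine isTwoPullback_of_cells ?_ (fun c d hcd => ?_) (fun χ χ' hp hq => ?_)
  · rw [← Strict.assoc, h.comm, Strict.assoc, h'.comm, Strict.assoc]
  · obtain ⟨d', hd, hd'⟩ := h'.exists_cell (c ▶ f) d (by rw [whiskerRight_whiskerRight, hcd])
    obtain ⟨χ, hχ, hχ'⟩ := h.exists_cell c d' hd.symm
    exact ⟨χ, hχ, by rw [← whiskerRight_whiskerRight, hχ', hd']⟩
  · refine h.cell_ext hp (h'.cell_ext ?_ ?_)
    · rw [whiskerRight_whiskerRight, whiskerRight_whiskerRight, ← h.comm,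
        ← whiskerRight_whiskerRight, hp, whiskerRight_whiskerRight]
    · rw [whiskerRight_whiskerRight, whiskerRight_whiskerRight, hq]

theorem isDiscreteOpfibration (h : IsTwoPullback p q f g) (hg : IsDiscreteOpfibration g) :
    IsDiscreteOpfibration p := by
  refine isDiscreteOpfibration_of_cells (fun e c hc => ?_) (fun l l' hsrc hl => ?_)
  · obtain ⟨d, hd, hd'⟩ := hg.exists_lift (e ≫ q) (c ▶ f) (by simp [hc, h.comm])
    obtain ⟨l, rfl, rfl⟩ := h.exists_cell c d hd'.symm
    exact ⟨l, h.hom_ext hc hd, rfl⟩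
  · refine h.cell_ext hl (hg.cell_ext (by simp [hsrc]) ?_)
    rw [whiskerRight_whiskerRight, whiskerRight_whiskerRight, ← h.comm,
      ← whiskerRight_whiskerRight, hl, whiskerRight_whiskerRight]

theorem exists_iso (h : IsTwoPullback p q f g) {P' : K} {p' : P' ⟶ A} {q' : P' ⟶ D}
    (h' : IsTwoPullback p' q' f g) :
    ∃ (k : P ⟶ P') (l : P' ⟶ P), k ≫ l = 𝟙 P ∧ l ≫ k = 𝟙 P' ∧ k ≫ p' = p ∧ k ≫ q' = q := by
  obtain ⟨k, hkp, hkq⟩ := h'.exists_hom p q h.comm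
  obtain ⟨l, hlp, hlq⟩ := h.exists_hom p' q' h'.comm
  refine ⟨k, l, h.hom_ext ?_ ?_, h'.hom_ext ?_ ?_, hkp, hkq⟩
  all_goals simp [hkp, hkq, hlp, hlq]

theorem eq_section {Z Y : K} {x y : Z ⟶ D} {z : Z ⟶ Y} {k : D ⟶ Y}
    (h : IsTwoPullback (𝟙 Z) x z k) (hy : y ≫ k = z) : y = x := by
  obtain ⟨l, hl, rfl⟩ := h.exists_hom (𝟙 Z) y (by rw [hy, Strict.id_comp])
  rw [Strict.comp_id] at hl
  rw [hl, Strict.id_comp]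

end IsTwoPullback

theorem isTwoPullback_of_iso {E E' B : K} {p : E ⟶ B} {p' : E' ⟶ B} {k : E ⟶ E'} {l : E' ⟶ E}
    (hkl : k ≫ l = 𝟙 E) (hlk : l ≫ k = 𝟙 E') (hk : k ≫ p' = p) :
    IsTwoPullback p k (𝟙 B) p' := by
  subst hk
  refine isTwoPullback_of_cells (by simp) (fun c d hcd => ⟨d ▶ l, ?_, ?_⟩) fun χ χ' _ hχ => ?_
  · rw [whiskerRight_whiskerRight, ← Strict.assoc, hlk, Strict.id_comp, ← hcd,
      TwoCell.whiskerRight_id]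
  · rw [whiskerRight_whiskerRight, hlk, TwoCell.whiskerRight_id]
  · simpa [whiskerRight_whiskerRight, hkl] using congrArg (· ▶ l) hχ

theorem isTwoPullback_map_of_iso (T : StrictPseudofunctor K K) {E E' B : K} {p : E ⟶ B}
    {p' : E' ⟶ B} {k : E ⟶ E'} {l : E' ⟶ E} (hkl : k ≫ l = 𝟙 E) (hlk : l ≫ k = 𝟙 E')
    (hk : k ≫ p' = p) : IsTwoPullback (T.map p) (T.map k) (𝟙 (T.obj B)) (T.map p') :=
  isTwoPullback_of_iso (l := T.map l) (by rw [← T.map_comp, hkl, T.map_id])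
    (by rw [← T.map_comp, hlk, T.map_id]) (by rw [← T.map_comp, hk])

theorem isTwoPullback_id {A B : K} (f : A ⟶ B) : IsTwoPullback (𝟙 A) f f (𝟙 B) :=
  (isTwoPullback_of_iso (Strict.id_comp _) (Strict.id_comp _) (Strict.id_comp f)).flip

/-- An isomorphism `i : d ≫ s ≅ 𝟙 E` gives a 2-cell from `d ≫ s` to `𝟙 E` that lies over an
identity, namely `i.inv ▷ (d ≫ s) ≫ i.hom`, and is therefore itself an identity. -/
theorem IsSplitEquivalence.exists_inverse {E E' B : K} {d : E ⟶ E'} (hd : IsSplitEquivalence d)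
    {q : E' ⟶ B} (hdq : IsDiscreteOpfibration (d ≫ q)) :
    ∃ s : E' ⟶ E, d ≫ s = 𝟙 E ∧ s ≫ d = 𝟙 E' := by
  obtain ⟨s, hsd, ⟨i⟩⟩ := hd
  have hdsdq : (d ≫ s) ≫ d ≫ q = d ≫ q := by
    rw [Strict.assoc, ← Strict.assoc s, hsd, Strict.id_comp]
  obtain ⟨c, hc⟩ := IsVComp.exists_of_tgt_eq_src (c := of i.inv ▶ (d ≫ s)) (d := of i.hom)
    (by rw [whiskerRight_tgt, Strict.assoc, ← Strict.assoc s, hsd, Strict.id_comp])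
  have hcq : c ▶ (d ≫ q) = of (𝟙 (d ≫ s)) ▶ (d ≫ q) := by
    have h := hc.whiskerRight (d ≫ q)
    rw [whiskerRight_whiskerRight, hdsdq] at h
    rw [h.unique ((IsVComp.of_comp i.inv i.hom).whiskerRight _), i.inv_hom_id, whiskerRight_of_id,
      whiskerRight_of_id, hdsdq, Strict.id_comp]
  have hc' : c = of (𝟙 (d ≫ s)) :=
    hdq.cell_ext (hc.src_eq.trans (Strict.id_comp (d ≫ s))) hcq
  exact ⟨s, (congrArg tgt hc').symm.trans hc.tgt_eq, hsd⟩

theorem isSplitEquivalence_id (A : K) : IsSplitEquivalence (𝟙 A) :=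
  ⟨𝟙 A, Strict.id_comp _, ⟨eqToIso (Strict.id_comp _)⟩⟩

variable [Enhanced K]

theorem IsLeftTightPullback.paste (h : IsLeftTightPullback p q f g) {E F : K} {r : D ⟶ E}
    {a : C ⟶ F} {k : E ⟶ F} (h' : IsTwoPullback g r a k) :
    IsLeftTightPullback p (q ≫ r) (f ≫ a) k :=
  ⟨h.toIsTwoPullback.paste h', h.tight_left, h.detects⟩

theorem isLeftTightPullback_id {A B : K} (f : A ⟶ B) : IsLeftTightPullback (𝟙 A) f f (𝟙 B) :=
  ⟨isTwoPullback_id f, Enhanced.tight_id A, fun h hh => by rwa [Strict.comp_id] at hh⟩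

theorem PullbackIdeal.small_of_isTwoPullback (hK : IsPlumbus K) (S : PullbackIdeal K)
    (hg : S.small g) (h : IsTwoPullback p q f g) (hp : Enhanced.tight p) : S.small p := by
  have hg' := S.isTightDiscreteOpfibration g hg
  obtain ⟨P', p', q', h'⟩ := hK.exists_pullback g f hg'
  obtain ⟨k, l, hkl, hlk, hk, -⟩ := h'.toIsTwoPullback.exists_iso h
  exact S.replete p' p k l hkl hlk hk (S.pullback _ _ _ _ h' hg)
    ⟨hp, h.isDiscreteOpfibration hg'.2⟩

end Pullback

end OpfibrationsAndPullbacks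

/-! ### Classifying maps -/

section ClassifyingMaps

variable {K : Type u} [Bicategory.{w, v} K] [Strict K]

open TwoCell

section PullbackOfCell

variable {Ωp Ω B E E' E'' : K} {u : Ωp ⟶ Ω} {f g h : B ⟶ Ω} {p : E ⟶ B} {e : E ⟶ Ωp}
  {p' : E' ⟶ B} {e' : E' ⟶ Ωp} {p'' : E'' ⟶ B} {e'' : E'' ⟶ Ωp} {φ : f ⟶ g} {ψ : g ⟶ h}
  {k : E ⟶ E'} {k' : E' ⟶ E''}

theorem isPullbackOfCell_of_twoCell (hk : k ≫ p' = p) (l : TwoCell E Ωp) (hsrc : l.src = e)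
    (htgt : l.tgt = k ≫ e') (hl : l ▶ u = p ◀ of φ) : IsPullbackOfCell u p e p' e' φ k := by
  obtain @⟨_, _, l⟩ := l
  cases hsrc
  cases htgt
  exact ⟨hk, l, heq_of_of_eq hl⟩

namespace IsPullbackOfCell

theorem exists_twoCell (hk : IsPullbackOfCell u p e p' e' φ k) (comm : p ≫ f = e ≫ u)
    (comm' : p' ≫ g = e' ≫ u) :
    ∃ l : TwoCell E Ωp, l.src = e ∧ l.tgt = k ≫ e' ∧ l ▶ u = p ◀ of φ := by
  obtain ⟨rfl, l, hl⟩ := hk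
  exact ⟨of l, rfl, rfl, of_eq_of_heq comm.symm (by simp [comm']) hl⟩

theorem id (comm : p ≫ f = e ≫ u) : IsPullbackOfCell u p e p e (𝟙 f) (𝟙 E) :=
  isPullbackOfCell_of_twoCell (Strict.id_comp p) (of (𝟙 e)) rfl (Strict.id_comp e).symm
    (by rw [whiskerRight_of_id, whiskerLeft_of_id, comm])

theorem comp (hk : IsPullbackOfCell u p e p' e' φ k) (hk' : IsPullbackOfCell u p' e' p'' e'' ψ k')
    (comm : p ≫ f = e ≫ u) (comm' : p' ≫ g = e' ≫ u) (comm'' : p'' ≫ h = e'' ≫ u) :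
    IsPullbackOfCell u p e p'' e'' (φ ≫ ψ) (k ≫ k') := by
  obtain ⟨l, hsrc, htgt, hl⟩ := hk.exists_twoCell comm comm'
  obtain ⟨l', hsrc', htgt', hl'⟩ := hk'.exists_twoCell comm' comm''
  obtain ⟨l'', hl''⟩ :=
    IsVComp.exists_of_tgt_eq_src (c := l) (d := k ◀ l') (by rw [htgt, whiskerLeft_src, hsrc'])
  refine isPullbackOfCell_of_twoCell (by rw [Strict.assoc, hk'.1, hk.1]) l''
    (hl''.src_eq.trans hsrc) (by rw [hl''.tgt_eq, whiskerLeft_tgt, htgt', Strict.assoc]) ?_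
  have hw := hl''.whiskerRight u
  rw [hl, whiskerLeft_whiskerRight, hl', whiskerLeft_whiskerLeft, hk.1] at hw
  exact hw.unique ((IsVComp.of_comp φ ψ).whiskerLeft p)

theorem unique (hu : IsDiscreteOpfibration u) (h' : IsTwoPullback p' e' g u)
    (comm : p ≫ f = e ≫ u) {k₁ k₂ : E ⟶ E'} (h₁ : IsPullbackOfCell u p e p' e' φ k₁)
    (h₂ : IsPullbackOfCell u p e p' e' φ k₂) : k₁ = k₂ := by
  obtain ⟨l₁, hsrc₁, htgt₁, hl₁⟩ := h₁.exists_twoCell comm h'.comm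
  obtain ⟨l₂, hsrc₂, htgt₂, hl₂⟩ := h₂.exists_twoCell comm h'.comm
  obtain rfl : l₁ = l₂ := hu.cell_ext (hsrc₁.trans hsrc₂.symm) (hl₁.trans hl₂.symm)
  exact h'.hom_ext (h₁.1.trans h₂.1.symm) (htgt₁.symm.trans htgt₂)

end IsPullbackOfCell

theorem IsTwoPullback.exists_isPullbackOfCell (h' : IsTwoPullback p' e' g u)
    (hu : IsDiscreteOpfibration u) (comm : p ≫ f = e ≫ u) (φ : f ⟶ g) :
    ∃ k : E ⟶ E', IsPullbackOfCell u p e p' e' φ k := by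
  obtain ⟨l, hsrc, hl⟩ := hu.exists_lift e (p ◀ of φ) comm
  obtain ⟨k, hk, hk'⟩ := h'.exists_hom p l.tgt (congrArg tgt hl).symm
  exact ⟨k, isPullbackOfCell_of_twoCell hk l hsrc hk'.symm hl⟩

end PullbackOfCell

section InitialSquare

variable {E B Ωp Ω : K} {p : E ⟶ B} {e : E ⟶ Ωp} {x : B ⟶ Ω} {u : Ωp ⟶ Ω}

/-- The commutative square `p ≫ x = e ≫ u` is an initial object of the category of all commutative
squares from `p` to `u`, whose morphisms are the compatible pairs of 2-cells. -/
structure IsInitialSquare (p : E ⟶ B) (e : E ⟶ Ωp) (x : B ⟶ Ω) (u : Ωp ⟶ Ω) : Prop where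
  comm : p ≫ x = e ≫ u
  existsUnique_cells : ∀ (y : B ⟶ Ω) (e' : E ⟶ Ωp), p ≫ y = e' ≫ u →
    ∃! c : (x ⟶ y) × (e ⟶ e'), p ◀ of c.1 = of c.2 ▶ u

namespace IsInitialSquare

theorem exists_cells (h : IsInitialSquare p e x u) {y : B ⟶ Ω} {e' : E ⟶ Ωp}
    (comm : p ≫ y = e' ≫ u) : ∃ (φ : x ⟶ y) (l : e ⟶ e'), p ◀ of φ = of l ▶ u :=
  let ⟨c, hc⟩ := (h.existsUnique_cells y e' comm).exists
  ⟨c.1, c.2, hc⟩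

theorem cells_ext (h : IsInitialSquare p e x u) {φ φ' : TwoCell B Ω} {l l' : TwoCell E Ωp}
    (hφ : φ.src = x) (hφ' : φ'.src = x) (hφtgt : φ.tgt = φ'.tgt)
    (hl : l.src = e) (hl' : l'.src = e) (hltgt : l.tgt = l'.tgt)
    (hw : p ◀ φ = l ▶ u) (hw' : p ◀ φ' = l' ▶ u) : φ = φ' ∧ l = l' := by
  obtain @⟨_, y, φ⟩ := φ
  obtain @⟨_, _, φ'⟩ := φ'
  obtain @⟨_, e', l⟩ := l
  obtain @⟨_, _, l'⟩ := l'
  cases hφ; cases hφ'; cases hφtgt; cases hl; cases hl'; cases hltgt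
  cases (h.existsUnique_cells y e' (congrArg tgt hw)).unique (y₁ := ⟨φ, l⟩) (y₂ := ⟨φ', l'⟩) hw hw'
  exact ⟨rfl, rfl⟩

end IsInitialSquare

end InitialSquare

variable [Enhanced K]

namespace PullbackIdeal.IsTwoClassifier

variable {S : PullbackIdeal K} {Ωp Ω : K} {u : Ωp ⟶ Ω}

theorem isTightDiscreteOpfibration (hu : S.IsTwoClassifier u) : IsTightDiscreteOpfibration u :=
  S.isTightDiscreteOpfibration u hu.small

theorem isDiscreteOpfibration (hu : S.IsTwoClassifier u) : IsDiscreteOpfibration u :=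
  hu.isTightDiscreteOpfibration.2

theorem tight_of_comp (hu : S.IsTwoClassifier u) {Z P A : K} {p : P ⟶ A} (hp : S.small p)
    {k : Z ⟶ P} (hk : Enhanced.tight (k ≫ p)) : Enhanced.tight k := by
  obtain ⟨x, e, hx⟩ := hu.classify p hp
  exact hx.detects k hk

theorem isLeftTightPullback (hu : S.IsTwoClassifier u) {P A D C : K} {p : P ⟶ A} {q : P ⟶ D}
    {f : A ⟶ C} {g : D ⟶ C} (hp : S.small p) (h : IsTwoPullback p q f g) :
    IsLeftTightPullback p q f g :=
  ⟨h, (S.isTightDiscreteOpfibration p hp).1, fun _ => hu.tight_of_comp hp⟩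

theorem isInitialSquare (hu : S.IsTwoClassifier u) (hK : IsPlumbus K) {B E : K} {p : E ⟶ B}
    {e : E ⟶ Ωp} {x : B ⟶ Ω} (h : IsLeftTightPullback p e x u) : IsInitialSquare p e x u := by
  refine ⟨h.comm, fun y e' comm => ?_⟩
  obtain ⟨P, p', q', h'⟩ := hK.exists_pullback u y hu.isTightDiscreteOpfibration
  obtain ⟨k, hk, rfl⟩ := h'.exists_hom p e' comm
  obtain ⟨φ, ⟨-, l, hl⟩, hφ⟩ := hu.fullyFaithful x y p e p' q' h h' k hk
  refine ⟨⟨φ, l⟩, (of_eq_of_heq h.comm.symm comm.symm hl).symm, ?_⟩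
  rintro ⟨φ', l'⟩ hw
  obtain rfl := hφ φ' ⟨hk, l', heq_of_of_eq hw.symm⟩
  have hl' : of l' = of l := IsDiscreteOpfibration.cell_ext hu.isDiscreteOpfibration rfl
    (hw.symm.trans (of_eq_of_heq h.comm.symm comm.symm hl).symm)
  rw [of_injective hl']

/-- The identity of the terminal object is small, hence classified by a point `s`. Its pullback
along `Ωp ⟶ t` is the identity of `Ωp`, so that `s` yields the initial commutative square from that
identity to `u`; comparing it with `𝟙 Ωp ≫ u = 𝟙 Ωp ≫ u` gives `c`. -/
theorem exists_point (hu : S.IsTwoClassifier u) (hK : IsPlumbus K) :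
    ∃ (t : K) (π : Ωp ⟶ t) (s : t ⟶ Ωp) (c : TwoCell Ωp Ωp), c.src = π ≫ s ∧ c.tgt = 𝟙 Ωp ∧
      IsLeftTightPullback (𝟙 t) s (s ≫ u) u := by
  obtain ⟨t, ht⟩ := hK.exists_terminal
  obtain ⟨f, s, hs⟩ := hu.classify (𝟙 t) (S.id_terminal t ht)
  obtain ⟨π, -⟩ := ht.exists_tight Ωp
  obtain rfl : f = s ≫ u := by rw [← hs.comm, Strict.id_comp]
  have hπ := (isLeftTightPullback_id π).paste hs.toIsTwoPullback
  obtain ⟨-, l, -⟩ := (hu.isInitialSquare hK hπ).exists_cells (y := u) (e' := 𝟙 Ωp) rfl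
  exact ⟨t, π, s, of l, rfl, rfl, hs⟩

/-- A fully faithful functor reflects isomorphisms. -/
theorem isIso_iff_of_isPullbackOfCell (hu : S.IsTwoClassifier u) {B E E' : K} {f g : B ⟶ Ω}
    {p : E ⟶ B} {e : E ⟶ Ωp} {p' : E' ⟶ B} {e' : E' ⟶ Ωp} (h : IsLeftTightPullback p e f u)
    (h' : IsLeftTightPullback p' e' g u) {φ : f ⟶ g} {k : E ⟶ E'}
    (hk : IsPullbackOfCell u p e p' e' φ k) :
    IsIso φ ↔ ∃ l : E' ⟶ E, k ≫ l = 𝟙 E ∧ l ≫ k = 𝟙 E' := by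
  have hu' : IsDiscreteOpfibration u := hu.isDiscreteOpfibration
  have hid := IsPullbackOfCell.id h.comm
  have hid' := IsPullbackOfCell.id h'.comm
  constructor
  · intro hφ
    obtain ⟨l, hl⟩ := h.exists_isPullbackOfCell hu' h'.comm (inv φ)
    have hkl := hk.comp hl h.comm h'.comm h.comm
    have hlk := hl.comp hk h'.comm h.comm h'.comm
    rw [IsIso.hom_inv_id] at hkl
    rw [IsIso.inv_hom_id] at hlk
    exact ⟨l, hkl.unique hu' h.toIsTwoPullback h.comm hid,
      hlk.unique hu' h'.toIsTwoPullback h'.comm hid'⟩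
  · rintro ⟨l, hkl, hlk⟩
    have hl : l ≫ p = p' := by rw [← hk.1, ← Strict.assoc, hlk, Strict.id_comp]
    obtain ⟨ψ, hψ, -⟩ := hu.fullyFaithful g f p' e' p e h' h l hl
    have hφψ := hk.comp hψ h.comm h'.comm h.comm
    have hψφ := hψ.comp hk h'.comm h.comm h'.comm
    rw [hkl] at hφψ
    rw [hlk] at hψφ
    exact ⟨ψ, (hu.fullyFaithful f f p e p e h h _ hid.1).unique hφψ hid,
      (hu.fullyFaithful g g p' e' p' e' h' h' _ hid'.1).unique hψφ hid'⟩

/-- The functor `(-)^* u` sends `φ` to the comparison `d` from `E₁` to the pullback of `p` along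
`β`, and `d` is invertible exactly when `E₁` is itself such a pullback. -/
theorem isIso_iff_isTwoPullback (hu : S.IsTwoClassifier u) (hK : IsPlumbus K) {B₁ E₁ B E : K}
    {p₁ : E₁ ⟶ B₁} {e₁ : E₁ ⟶ Ωp} {x : B₁ ⟶ Ω} (h₁ : IsLeftTightPullback p₁ e₁ x u)
    {p : E ⟶ B} {e : E ⟶ Ωp} {f : B ⟶ Ω} (h : IsLeftTightPullback p e f u)
    {α : E₁ ⟶ E} {β : B₁ ⟶ B} (comm : p₁ ≫ β = α ≫ p) {φ : x ⟶ β ≫ f} {l : e₁ ⟶ α ≫ e}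
    (hw : p₁ ◀ of φ = of l ▶ u) : IsIso φ ↔ IsTwoPullback p₁ α β p := by
  have hu' : IsDiscreteOpfibration u := hu.isDiscreteOpfibration
  constructor
  · intro hφ
    obtain ⟨P, p', q', h'⟩ := hK.exists_pullback p β ⟨h.tight_left, h.isDiscreteOpfibration hu'⟩
    obtain ⟨d, hd, rfl⟩ := h'.exists_hom p₁ α comm
    have hk := isPullbackOfCell_of_twoCell hd (of l) rfl (Strict.assoc d q' e) hw.symm
    obtain ⟨s, hds, hsd⟩ :=
      (hu.isIso_iff_of_isPullbackOfCell h₁ (h'.paste h.toIsTwoPullback) hk).1 hφ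
    have := (isTwoPullback_of_iso hds hsd hd).paste h'.toIsTwoPullback
    rwa [Strict.id_comp] at this
  · intro h'
    have hk : IsPullbackOfCell u p₁ e₁ p₁ (α ≫ e) φ (𝟙 E₁) :=
      isPullbackOfCell_of_twoCell (Strict.id_comp p₁) (of l) rfl (Strict.id_comp _).symm hw.symm
    have hβf : IsLeftTightPullback p₁ (α ≫ e) (β ≫ f) u :=
      ⟨h'.paste h.toIsTwoPullback, h₁.tight_left, h₁.detects⟩
    exact (hu.isIso_iff_of_isPullbackOfCell h₁ hβf hk).2
      ⟨𝟙 E₁, Strict.id_comp _, Strict.id_comp _⟩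

end PullbackIdeal.IsTwoClassifier

end ClassifyingMaps

section CommaObjects

variable {K : Type u} [Bicategory.{w, v} K] [Strict K] {X B : K} {b : X ⟶ B}

open TwoCell

namespace RepComma

variable (C : RepComma b)

theorem exists_hom {Z : K} (x : Z ⟶ X) (c : TwoCell Z B) (h : c.src = x ≫ b) :
    ∃ k : Z ⟶ C.pt, k ≫ C.dom = x ∧ k ◀ of C.cell = c := by
  obtain @⟨_, y, ψ⟩ := c
  cases h
  obtain ⟨k, ⟨hdom, hcod, hk⟩, -⟩ := C.lift x y ψ
  exact ⟨k, hdom, of_eq_of_heq (by subst hdom; exact (Strict.assoc _ _ _).symm) hcod hk⟩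

theorem hom_ext {Z : K} {k k' : Z ⟶ C.pt} (hdom : k ≫ C.dom = k' ≫ C.dom)
    (hcell : k ◀ of C.cell = k' ◀ of C.cell) : k = k' := by
  have hsrc : k' ≫ C.dom ≫ b = (k' ≫ C.dom) ≫ b := (Strict.assoc _ _ _).symm
  refine (C.lift (k' ≫ C.dom) (k' ≫ C.cod) (eqToHom hsrc.symm ≫ k' ◁ C.cell)).unique
    ⟨hdom, congrArg tgt hcell, ?_⟩ ⟨rfl, rfl, ?_⟩
  · exact heq_of_of_eq (hcell.trans (of_eqToHom_comp _ _).symm)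
  · exact heq_of_of_eq (of_eqToHom_comp _ _).symm

theorem exists_iso (C' : RepComma b) :
    ∃ (j : C.pt ⟶ C'.pt) (k : C'.pt ⟶ C.pt), j ≫ k = 𝟙 C.pt ∧ k ≫ j = 𝟙 C'.pt ∧
      j ≫ C'.dom = C.dom ∧ j ◀ of C'.cell = of C.cell := by
  obtain ⟨j, hj, hj'⟩ := C'.exists_hom C.dom (of C.cell) rfl
  obtain ⟨k, hk, hk'⟩ := C.exists_hom C'.dom (of C'.cell) rfl
  refine ⟨j, k, C.hom_ext ?_ ?_, C'.hom_ext ?_ ?_, hj, hj'⟩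
  all_goals simp [← whiskerLeft_whiskerLeft, hj, hk, hj', hk']

end RepComma

end CommaObjects

/-! ### Algebras and lax morphisms -/

section Algebras

variable {K : Type u} [Bicategory.{w, v} K] [Strict K] [Enhanced K]

open TwoCell

namespace EnhancedTwoMonad

instance : Coe (EnhancedTwoMonad K) (StrictPseudofunctor K K) := ⟨toStrictPseudofunctor⟩

section Monad

variable (T : EnhancedTwoMonad K) {A B C : K}

theorem i_comp_map_comp (f : A ⟶ B) (g : T.obj B ⟶ C) : T.i A ≫ T.map f ≫ g = f ≫ T.i B ≫ g := by
  rw [← Strict.assoc, T.i_naturality, Strict.assoc]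

theorem m_comp_map_comp (f : A ⟶ B) (g : T.obj B ⟶ C) :
    T.m A ≫ T.map f ≫ g = T.map (T.map f) ≫ T.m B ≫ g := by
  rw [← Strict.assoc, T.m_naturality, Strict.assoc]

theorem whiskerLeft_i_map (c : TwoCell A B) : T.i A ◀ c.map T = c ▶ T.i B :=
  of_eq_of_heq (T.i_naturality _) (T.i_naturality _) (T.i_naturality₂ c.cell)

theorem whiskerLeft_m_map (c : TwoCell A B) : T.m A ◀ c.map T = (c.map T).map T ▶ T.m B :=
  of_eq_of_heq (T.m_naturality _) (T.m_naturality _) (T.m_naturality₂ c.cell)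

variable {T}

theorem IsAlgebra.unit_comp {a : T.obj A ⟶ A} (ha : T.IsAlgebra a) (f : A ⟶ B) :
    T.i A ≫ a ≫ f = f := by
  rw [← Strict.assoc, ha.unit, Strict.id_comp]

theorem IsAlgebra.assoc_comp {a : T.obj A ⟶ A} (ha : T.IsAlgebra a) (f : A ⟶ B) :
    T.m A ≫ a ≫ f = T.map a ≫ a ≫ f := by
  rw [← Strict.assoc, ha.assoc, Strict.assoc]

end Monad

variable {T : EnhancedTwoMonad K} {A B D Z : AlgLx T}

namespace LaxHom

/-- The laxator of a lax `T`-morphism, as a bundled 2-cell. -/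
def laxCell (F : A ⟶ B) : TwoCell (T.obj A.carrier) B.carrier := of (lax F)

@[simp] theorem laxCell_src (F : A ⟶ B) : (laxCell F).src = T.map (map F) ≫ B.str := rfl
@[simp] theorem laxCell_tgt (F : A ⟶ B) : (laxCell F).tgt = A.str ≫ map F := rfl

theorem ext_laxCell {F G : A ⟶ B} (h : map F = map G) (h' : laxCell F = laxCell G) : F = G :=
  LaxHom.ext h (heq_of_of_eq h')

theorem whiskerLeft_i_laxCell (F : A ⟶ B) : T.i A.carrier ◀ laxCell F = of (𝟙 (map F)) :=
  of_eq_of_heq (by rw [laxCell_src, i_comp_map_comp, B.isAlgebra.unit, Strict.comp_id])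
    (A.isAlgebra.unit_comp _) (lax_unit F)

theorem isVComp_laxCell (F : A ⟶ B) :
    IsVComp ((laxCell F).map T ▶ B.str) (T.map A.str ◀ laxCell F) (T.m A.carrier ◀ laxCell F) := by
  have h : T.m A.carrier ◀ laxCell F = of _ :=
    of_eq_of_heq (by rw [laxCell_src, m_comp_map_comp, B.isAlgebra.assoc, T.map_comp, Strict.assoc])
      (A.isAlgebra.assoc_comp _) (lax_mult F)
  rw [h]
  exact IsVComp.of_comp_eqToHom_comp _ _ _

theorem exists_of_laxCell (f : A.carrier ⟶ B.carrier) (c : TwoCell (T.obj A.carrier) B.carrier)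
    (hsrc : c.src = T.map f ≫ B.str) (htgt : c.tgt = A.str ≫ f)
    (hunit : T.i A.carrier ◀ c = of (𝟙 f))
    (hmult : IsVComp (c.map T ▶ B.str) (T.map A.str ◀ c) (T.m A.carrier ◀ c)) :
    ∃ F : A ⟶ B, map F = f ∧ laxCell F = c := by
  obtain @⟨_, _, c⟩ := c
  cases hsrc
  cases htgt
  exact ⟨⟨f, c, heq_of_of_eq hunit,
    heq_of_of_eq (hmult.unique (IsVComp.of_comp_eqToHom_comp _ _ _))⟩, rfl, rfl⟩

theorem isVComp_laxCell_comp (F : A ⟶ B) (G : B ⟶ D) :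
    IsVComp (T.map (map F) ◀ laxCell G) (laxCell F ▶ map G) (laxCell (F ≫ G)) := by
  have h : laxCell (F ≫ G) = of (T.map (map F) ◁ lax G ≫ eqToHom (Strict.assoc _ _ _).symm ≫
      lax F ▷ map G) := by
    refine (of_eqToHom_comp _ _).trans ?_
    simp only [← Category.assoc]
    exact of_comp_eqToHom _ _
  rw [h]
  exact IsVComp.of_comp_eqToHom_comp _ _ _

/-- A lax `T`-morphism is strict when its laxator is an identity. -/
def IsStrict (F : A ⟶ B) : Prop := laxCell F = of (𝟙 (T.map (map F) ≫ B.str))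

theorem isStrict_ofStrict (f : A.carrier ⟶ B.carrier) (hf : T.map f ≫ B.str = A.str ≫ f) :
    IsStrict (A := A) (B := B) (ofStrict f hf) :=
  of_eqToHom hf

theorem IsStrict.comm {F : A ⟶ B} (hF : IsStrict F) :
    T.map (map F) ≫ B.str = A.str ≫ map F :=
  (congrArg tgt hF).symm

theorem tight_iff {F : A ⟶ B} : Enhanced.tight F ↔ Enhanced.tight (map F) ∧ IsStrict F :=
  and_congr_right fun _ => ⟨fun ⟨h, hF⟩ => (congrArg of hF).trans (of_eqToHom h),
    fun hF => ⟨hF.comm, of_injective (hF.trans (of_eqToHom hF.comm).symm)⟩⟩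

theorem IsStrict.laxCell_comp {P : A ⟶ B} (hP : IsStrict P) (F : B ⟶ D) :
    laxCell (P ≫ F) = T.map (map P) ◀ laxCell F := by
  have h := isVComp_laxCell_comp P F
  rw [hP, whiskerRight_of_id] at h
  exact h.eq_left

theorem IsStrict.comp_laxCell {P : B ⟶ D} (hP : IsStrict P) (F : A ⟶ B) :
    laxCell (F ≫ P) = laxCell F ▶ map P := by
  have h := isVComp_laxCell_comp F P
  rw [hP, whiskerLeft_of_id] at h
  exact h.eq_right

theorem IsStrict.comp_eq_comp_iff {Q : AlgLx T} {P : A ⟶ B} {U : D ⟶ Q} (hP : IsStrict P)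
    (hU : IsStrict U) {F : B ⟶ Q} {E : A ⟶ D} (h : map P ≫ map F = map E ≫ map U) :
    P ≫ F = E ≫ U ↔ T.map (map P) ◀ laxCell F = laxCell E ▶ map U := by
  rw [← hP.laxCell_comp, ← hU.comp_laxCell]
  exact ⟨congrArg laxCell, ext_laxCell h⟩

/-- The underlying 2-cell of a bundled `T`-2-morphism. -/
def forget (c : TwoCell A B) : TwoCell A.carrier B.carrier := of (Cell.cell c.cell)

theorem exists_isVComp_forget (c : TwoCell A B) :
    ∃ e, IsVComp ((forget c).map T ▶ B.str) (laxCell c.tgt) e ∧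
      IsVComp (laxCell c.src) (A.str ◀ forget c) e :=
  ⟨_, .of_comp _ _, Cell.comm c.cell ▸ .of_comp _ _⟩

theorem forget_ext {c c' : TwoCell A B} (hsrc : c.src = c'.src) (htgt : c.tgt = c'.tgt)
    (h : forget c = forget c') : c = c' := by
  obtain @⟨_, _, c⟩ := c
  obtain @⟨_, _, c'⟩ := c'
  cases hsrc
  cases htgt
  exact congrArg of (LaxHom.hom_ext (of_injective h))

theorem exists_forget_eq (F G : A ⟶ B) (c : TwoCell A.carrier B.carrier) (hsrc : c.src = map F)
    (htgt : c.tgt = map G) {e : TwoCell (T.obj A.carrier) B.carrier}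
    (h : IsVComp (c.map T ▶ B.str) (laxCell G) e) (h' : IsVComp (laxCell F) (A.str ◀ c) e) :
    ∃ d : TwoCell A B, d.src = F ∧ d.tgt = G ∧ forget d = c := by
  obtain @⟨_, _, c⟩ := c
  cases hsrc
  cases htgt
  obtain rfl := h.unique (.of_comp _ _)
  exact ⟨of ⟨c, of_injective (h'.unique (.of_comp _ _))⟩, rfl, rfl, rfl⟩

/-! ### Limits and discrete opfibrations of algebras -/

namespace IsStrict

variable {P : A ⟶ B}

/-- Along a discrete opfibration, the axioms for a laxator can be checked on its image. -/
theorem exists_hom_comp_eq (hP : IsStrict P) (hp : IsDiscreteOpfibration (map P)) (x : Z ⟶ B)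
    {h : Z.carrier ⟶ A.carrier} (hx : h ≫ map P = map x) (c : TwoCell (T.obj Z.carrier) A.carrier)
    (hsrc : c.src = T.map h ≫ A.str) (htgt : c.tgt = Z.str ≫ h) (hc : c ▶ map P = laxCell x) :
    ∃ H : Z ⟶ A, map H = h ∧ laxCell H = c ∧ H ≫ P = x := by
  have hunit : T.i Z.carrier ◀ c = of (𝟙 h) := by
    refine hp.cell_ext ?_ ?_
    · rw [whiskerLeft_src, hsrc, i_comp_map_comp, A.isAlgebra.unit, Strict.comp_id]
    · rw [whiskerLeft_whiskerRight, hc, whiskerLeft_i_laxCell, whiskerRight_of_id, hx]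
  have hmult : IsVComp (c.map T ▶ A.str) (T.map Z.str ◀ c) (T.m Z.carrier ◀ c) := by
    refine hp.isVComp_of_whiskerRight ?_ ?_ ?_
    · simp [hsrc, m_comp_map_comp, A.isAlgebra.assoc, T.map_comp]
    · simp [hsrc, htgt, T.map_comp]
    · rw [whiskerRight_whiskerRight, ← hP.comm, ← whiskerRight_whiskerRight, ← map_whiskerRight,
        whiskerLeft_whiskerRight, whiskerLeft_whiskerRight, hc]
      exact isVComp_laxCell x
  obtain ⟨H, rfl, rfl⟩ := exists_of_laxCell h c hsrc htgt hunit hmult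
  exact ⟨H, rfl, rfl, ext_laxCell hx ((hP.comp_laxCell H).trans hc)⟩

theorem hom_ext (hP : IsStrict P) (hp : IsDiscreteOpfibration (map P)) {k l : Z ⟶ A}
    (hmap : map k = map l) (hcomp : k ≫ P = l ≫ P) : k = l :=
  ext_laxCell hmap (hp.cell_ext (by simp [hmap])
    (by rw [← hP.comp_laxCell, hcomp, hP.comp_laxCell]))

/-- The target of the lift of a `T`-2-morphism `c` receives as laxator the lift of the laxator of
the target of `c`. -/
theorem exists_lift (hP : IsStrict P) (hp : IsDiscreteOpfibration (map P)) (F : Z ⟶ A)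
    (c : TwoCell Z B) (hc : c.src = F ≫ P) : ∃ l : TwoCell Z A, l.src = F ∧ l ▶ P = c := by
  obtain ⟨l, hlsrc, hl⟩ := hp.exists_lift (map F) (forget c) (congrArg map hc)
  have hltgt : l.tgt ≫ map P = map c.tgt := congrArg tgt hl
  obtain ⟨k, hksrc, hk⟩ := hp.exists_lift (T.map l.tgt ≫ A.str) (laxCell c.tgt)
    (by rw [laxCell_src, ← hltgt, T.map_comp, Strict.assoc, Strict.assoc, hP.comm])
  obtain ⟨e, he⟩ := IsVComp.exists_of_tgt_eq_src (c := l.map T ▶ A.str) (d := k) (by simp [hksrc])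
  have he' : IsVComp (laxCell F) (Z.str ◀ l) e := by
    obtain ⟨e', h₁, h₂⟩ := exists_isVComp_forget c
    refine hp.isVComp_of_whiskerRight (by simp [he.src_eq, hlsrc]) (by simp [hlsrc]) ?_
    rw [← hP.comp_laxCell, ← hc, whiskerLeft_whiskerRight, hl]
    have h := he.whiskerRight (map P)
    rw [whiskerRight_whiskerRight, ← hP.comm, ← whiskerRight_whiskerRight, ← map_whiskerRight, hl,
      hk] at h
    rwa [h.unique h₁]
  obtain ⟨G, hGmap, rfl, hG⟩ := hP.exists_hom_comp_eq hp c.tgt hltgt k hksrc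
    (he.tgt_eq.symm.trans he'.tgt_eq) hk
  obtain ⟨d, rfl, rfl, rfl⟩ := exists_forget_eq F G l hlsrc hGmap.symm he he'
  exact ⟨d, rfl, forget_ext hc.symm hG hl⟩

theorem isDiscreteOpfibration (hP : IsStrict P) (hp : IsDiscreteOpfibration (map P)) :
    IsDiscreteOpfibration P := by
  refine isDiscreteOpfibration_of_cells (hP.exists_lift hp) fun l l' hsrc hl => ?_
  have h : forget l = forget l' := hp.cell_ext (congrArg map hsrc) (congrArg forget hl)
  exact forget_ext hsrc (hP.hom_ext hp (congrArg tgt h) (congrArg tgt hl)) h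

variable {Q : AlgLx T} {U : D ⟶ Q} {F : B ⟶ Q} {E : A ⟶ D}

theorem exists_hom_of_isTwoPullback (hP : IsStrict P) (hp : IsDiscreteOpfibration (map P))
    (hU : IsStrict U) (hu : IsDiscreteOpfibration (map U)) (comm : P ≫ F = E ≫ U)
    (h : IsTwoPullback (map P) (map E) (map F) (map U)) (x : Z ⟶ B) (y : Z ⟶ D)
    (hxy : x ≫ F = y ≫ U) : ∃ k : Z ⟶ A, k ≫ P = x ∧ k ≫ E = y := by
  obtain ⟨k, hkx, hky⟩ := h.exists_hom (map x) (map y) (congrArg map hxy)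
  obtain ⟨c, hcsrc, hc⟩ := hp.exists_lift (T.map k ≫ A.str) (laxCell x)
    (by rw [laxCell_src, ← hkx, T.map_comp, Strict.assoc, Strict.assoc, hP.comm])
  have hy : IsVComp (T.map k ◀ laxCell E) (c ▶ map E) (laxCell y) := by
    refine hu.isVComp_of_whiskerRight (by simp [← hky, T.map_comp]) (by simp [hcsrc]) ?_
    rw [whiskerLeft_whiskerRight, ← (hP.comp_eq_comp_iff hU h.comm).1 comm,
      whiskerLeft_whiskerLeft, ← T.map_comp, hkx, whiskerRight_whiskerRight, ← h.comm,
      ← whiskerRight_whiskerRight, hc, ← hU.comp_laxCell, ← hxy]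
    exact isVComp_laxCell_comp x F
  have hctgt : c.tgt = Z.str ≫ k := by
    refine h.hom_ext ?_ ?_
    · rw [Strict.assoc, hkx]
      exact congrArg tgt hc
    · rw [Strict.assoc, hky]
      exact hy.tgt_eq.symm
  obtain ⟨H, rfl, rfl, hH⟩ := hP.exists_hom_comp_eq hp x hkx c hcsrc hctgt hc
  exact ⟨H, hH, ext_laxCell hky ((isVComp_laxCell_comp H E).unique hy)⟩

theorem isTwoPullback (hP : IsStrict P) (hp : IsDiscreteOpfibration (map P)) (hU : IsStrict U)
    (hu : IsDiscreteOpfibration (map U)) (comm : P ≫ F = E ≫ U)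
    (h : IsTwoPullback (map P) (map E) (map F) (map U)) : IsTwoPullback P E F U :=
  isTwoPullback_of_isDiscreteOpfibration (hP.isDiscreteOpfibration hp)
    (hU.isDiscreteOpfibration hu) comm (hP.exists_hom_of_isTwoPullback hp hU hu comm h)
    fun hkP hkE => hP.hom_ext hp (h.hom_ext (congrArg map hkP) (congrArg map hkE)) hkP

theorem of_comp (hP : IsStrict P) (hp : IsDiscreteOpfibration (map P)) {k : Z ⟶ A}
    (hk : IsStrict (k ≫ P)) : IsStrict k := by
  refine hp.cell_ext rfl ?_
  rw [← hP.comp_laxCell, hk, whiskerRight_of_id, Strict.assoc, ← hP.comm, ← Strict.assoc,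
    ← T.map_comp]
  rfl

theorem isLeftTightPullback (hP : IsStrict P) (hU : IsStrict U)
    (hu : IsDiscreteOpfibration (map U)) (comm : P ≫ F = E ≫ U)
    (h : IsLeftTightPullback (map P) (map E) (map F) (map U)) : IsLeftTightPullback P E F U := by
  have hp : IsDiscreteOpfibration (map P) := h.isDiscreteOpfibration hu
  refine ⟨hP.isTwoPullback hp hU hu comm h.toIsTwoPullback, tight_iff.2 ⟨h.tight_left, hP⟩, ?_⟩
  intro Z k hk
  obtain ⟨hk, hkP⟩ := tight_iff.1 hk
  exact tight_iff.2 ⟨h.detects _ hk, hP.of_comp hp hkP⟩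

end IsStrict

end LaxHom

/-! ### The comma object of a colax morphism -/

section Comma

variable {X B : AlgLx T}

namespace ColaxHom

/-- The colaxator of a colax `T`-morphism, as a bundled 2-cell. -/
def colaxCell (b : ColaxHom X B) : TwoCell (T.obj X.carrier) B.carrier := of b.colax

theorem colaxCell_tgt (b : ColaxHom X B) : b.colaxCell.tgt = T.map b.map ≫ B.str := rfl

theorem whiskerLeft_i_colaxCell (b : ColaxHom X B) :
    T.i X.carrier ◀ b.colaxCell = of (𝟙 b.map) :=
  of_eq_of_heq (X.isAlgebra.unit_comp _)
    (by rw [colaxCell_tgt, i_comp_map_comp, B.isAlgebra.unit, Strict.comp_id]) b.colax_unit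

theorem isVComp_colaxCell (b : ColaxHom X B) :
    IsVComp (T.map X.str ◀ b.colaxCell) (b.colaxCell.map T ▶ B.str)
      (T.m X.carrier ◀ b.colaxCell) := by
  have h : T.m X.carrier ◀ b.colaxCell = of _ :=
    of_eq_of_heq (X.isAlgebra.assoc_comp _)
      (by rw [colaxCell_tgt, m_comp_map_comp, B.isAlgebra.assoc, T.map_comp, Strict.assoc])
      b.colax_mult
  rw [h]
  exact IsVComp.of_comp_eqToHom_comp _ _ _

variable (b : ColaxHom X B) (C : RepComma b.map)

theorem commaStr_dom : b.commaStr C ≫ C.dom = T.map C.dom ≫ X.str := (b.commaStr_spec C).1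

theorem commaStr_cod : b.commaStr C ≫ C.cod = T.map C.cod ≫ B.str := (b.commaStr_spec C).2.1

theorem isVComp_commaStr :
    IsVComp (T.map C.dom ◀ b.colaxCell) ((of C.cell).map T ▶ B.str)
      (b.commaStr C ◀ of C.cell) := by
  have h : b.commaStr C ◀ of C.cell = of (b.commaCell C) :=
    of_eq_of_heq (by rw [← Strict.assoc, commaStr_dom]) (b.commaStr_cod C) (b.commaStr_spec C).2.2
  rw [h, commaCell, Strict.associator_eqToIso, eqToIso.hom, of_eqToHom_comp]
  exact IsVComp.of_comp_eqToHom_comp _ _ _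

theorem i_comp_commaStr : T.i C.pt ≫ b.commaStr C = 𝟙 C.pt := by
  refine C.hom_ext ?_ ?_
  · rw [Strict.assoc, commaStr_dom, i_comp_map_comp, X.isAlgebra.unit, Strict.comp_id,
      Strict.id_comp]
  · have h := (b.isVComp_commaStr C).whiskerLeft (T.i C.pt)
    rw [whiskerLeft_whiskerLeft, T.i_naturality, ← whiskerLeft_whiskerLeft,
      whiskerLeft_i_colaxCell, whiskerLeft_of_id, ← whiskerLeft_whiskerRight, whiskerLeft_i_map,
      whiskerRight_whiskerRight, B.isAlgebra.unit, TwoCell.whiskerRight_id,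
      whiskerLeft_whiskerLeft] at h
    rw [h.eq_right, TwoCell.id_whiskerLeft]

/-- Both sides induce the composite of three 2-cells: two whiskered colaxators followed by `T` of
`T` of the comma cell. -/
theorem m_comp_commaStr :
    T.m C.pt ≫ b.commaStr C = T.map (b.commaStr C) ≫ b.commaStr C := by
  have hdom : T.map (b.commaStr C) ≫ T.map C.dom = T.map (T.map C.dom) ≫ T.map X.str := by
    rw [← T.map_comp, commaStr_dom, T.map_comp]
  refine C.hom_ext ?_ ?_
  · rw [Strict.assoc, Strict.assoc, commaStr_dom, m_comp_map_comp, X.isAlgebra.assoc,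
      ← Strict.assoc, ← Strict.assoc, hdom]
  · have hm := (b.isVComp_commaStr C).whiskerLeft (T.m C.pt)
    have hxy := (isVComp_colaxCell b).whiskerLeft (T.map (T.map C.dom))
    have hyz := ((b.isVComp_commaStr C).map T).whiskerRight B.str
    have hT := (b.isVComp_commaStr C).whiskerLeft (T.map (b.commaStr C))
    rw [whiskerLeft_whiskerLeft, T.m_naturality, ← whiskerLeft_whiskerLeft,
      ← whiskerLeft_whiskerRight, whiskerLeft_m_map, whiskerRight_whiskerRight,
      B.isAlgebra.assoc, whiskerLeft_whiskerLeft _ (b.commaStr C)] at hm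
    rw [map_whiskerLeft, whiskerLeft_whiskerRight, map_whiskerRight, whiskerRight_whiskerRight,
      map_whiskerLeft] at hyz
    rw [whiskerLeft_whiskerLeft, hdom, ← whiskerLeft_whiskerLeft, ← whiskerLeft_whiskerRight,
      whiskerLeft_whiskerLeft _ (b.commaStr C)] at hT
    exact (hxy.assoc hyz hm).unique hT

theorem isAlgebra_commaStr (h : Enhanced.tight (b.commaStr C)) : T.IsAlgebra (b.commaStr C) :=
  ⟨h, b.i_comp_commaStr C, b.m_comp_commaStr C⟩

theorem commaStr_comp {C C' : RepComma b.map} {j : C.pt ⟶ C'.pt} (hdom : j ≫ C'.dom = C.dom)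
    (hcell : j ◀ of C'.cell = of C.cell) : b.commaStr C ≫ j = T.map j ≫ b.commaStr C' := by
  refine C'.hom_ext ?_ ?_
  · rw [Strict.assoc, hdom, commaStr_dom, Strict.assoc, commaStr_dom, ← Strict.assoc, ← T.map_comp,
      hdom]
  · have h := (b.isVComp_commaStr C').whiskerLeft (T.map j)
    rw [whiskerLeft_whiskerLeft, ← T.map_comp, hdom, ← whiskerLeft_whiskerRight, ← map_whiskerLeft,
      hcell, whiskerLeft_whiskerLeft] at h
    rw [← whiskerLeft_whiskerLeft, hcell]
    exact (b.isVComp_commaStr C).unique h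

end ColaxHom

end Comma

/-! ### Cartesian morphisms -/

/-- The comparison of a discrete opfibration with the pullback is a split equivalence only if it is
invertible. -/
theorem isCartesian_iff_isTwoPullback {A B : K} {a : T.obj A ⟶ A} {b : T.obj B ⟶ B} {f : A ⟶ B}
    (hf : IsDiscreteOpfibration (T.map f)) :
    T.IsCartesian a b f ↔ IsTwoPullback (T.map f) a b f := by
  constructor
  · rintro ⟨-, P, p, q, d, hP, rfl, hdq, hd⟩
    obtain ⟨s, hds, hsd⟩ := hd.exists_inverse (q := q) (by rwa [hdq])
    have := (isTwoPullback_of_iso hds hsd hdq).paste hP.flip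
    rwa [Strict.id_comp] at this
  · exact fun h => ⟨h.comm, _, a, T.map f, 𝟙 _, h.flip, Strict.id_comp _, Strict.id_comp _,
      isSplitEquivalence_id _⟩

namespace ColaxHom

variable {X B : AlgLx T} (b : ColaxHom X B)

theorem isTwoPullback_commaStr_of_repComma (C C' : RepComma b.map)
    (h : IsTwoPullback (T.map C'.cod) (b.commaStr C') B.str C'.cod) :
    IsTwoPullback (T.map C.cod) (b.commaStr C) B.str C.cod := by
  obtain ⟨j, k, hjk, hkj, hdom, hcell⟩ := C.exists_iso C'
  have hcod : j ≫ C'.cod = C.cod := congrArg tgt hcell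
  have hk : IsTwoPullback C'.cod k (𝟙 _) C.cod :=
    isTwoPullback_of_iso hkj hjk (by rw [← hcod, ← Strict.assoc, hkj, Strict.id_comp])
  have := ((isTwoPullback_map_of_iso T hjk hkj hcod).paste h).paste hk
  rwa [← b.commaStr_comp hdom hcell, Strict.assoc, hjk, Strict.comp_id, Strict.comp_id,
    Strict.id_comp] at this

theorem isCartesianAt_iff_isTwoPullback (C : RepComma b.map)
    (hC : IsDiscreteOpfibration (T.map C.cod)) :
    b.IsCartesianAt ↔ IsTwoPullback (T.map C.cod) (b.commaStr C) B.str C.cod := by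
  refine ⟨fun ⟨C', h⟩ => ?_, fun h => ⟨C, (isCartesian_iff_isTwoPullback hC).2 h⟩⟩
  obtain ⟨j, k, hjk, hkj, -, hcell⟩ := C'.exists_iso C
  have hC' : IsDiscreteOpfibration (T.map C'.cod) :=
    (isTwoPullback_map_of_iso T hjk hkj (congrArg tgt hcell)).isDiscreteOpfibration hC
  exact b.isTwoPullback_commaStr_of_repComma C C' ((isCartesian_iff_isTwoPullback hC').1 h)

end ColaxHom

/-! ### The classifier of algebras -/

namespace LiftsClassifier

variable {S : PullbackIdeal K}

section Top

variable {Ωp Ω : K} {u : Ωp ⟶ Ω} {ωp : T.obj Ωp ⟶ Ωp} {ω : T.obj Ω ⟶ Ω}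

theorem isLeftTightPullback (hT : T.LiftsClassifier S u ωp ω) (hK : IsPlumbus K)
    (hu : S.IsTwoClassifier u) {E B : K} {p : E ⟶ B} {e : E ⟶ Ωp} {f : B ⟶ Ω}
    (h : IsLeftTightPullback p e f u) :
    IsLeftTightPullback (T.map p) (T.map e ≫ ωp) (T.map f ≫ ω) u := by
  have hTp := hT.map_pullback p e f h
  have hsmall := S.small_of_isTwoPullback hK hT.small hTp (T.map_tight p h.tight_left)
  exact (hu.isLeftTightPullback hsmall hTp).paste hT.classifies.toIsTwoPullback

theorem i_comp_top (hT : T.LiftsClassifier S u ωp ω) (hK : IsPlumbus K)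
    (hu : S.IsTwoClassifier u) : T.i Ωp ≫ ωp = 𝟙 Ωp := by
  obtain ⟨t, π, s, c, hsrc, htgt, hs⟩ := hu.exists_point hK
  have h : (T.i Ωp ≫ ωp) ≫ u = 𝟙 Ωp ≫ u := by
    rw [Strict.assoc, ← hT.classifies.comm, i_comp_map_comp, hT.isAlgebra.unit, Strict.comp_id,
      Strict.id_comp]
  refine IsDiscreteOpfibration.hom_ext_of_point hu.isDiscreteOpfibration hsrc htgt h ?_
  rw [Strict.comp_id]
  exact hs.eq_section (by rw [Strict.assoc, h, Strict.id_comp])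

theorem m_comp_top (hT : T.LiftsClassifier S u ωp ω) (hK : IsPlumbus K)
    (hu : S.IsTwoClassifier u) : T.m Ωp ≫ ωp = T.map ωp ≫ ωp := by
  obtain ⟨t, π, s, c, hsrc, htgt, hs⟩ := hu.exists_point hK
  have h : (T.m Ωp ≫ ωp) ≫ u = (T.map ωp ≫ ωp) ≫ u := by
    have hωp : T.map (T.map u) ≫ T.map ω = T.map ωp ≫ T.map u := by
      rw [← T.map_comp, hT.classifies.comm, T.map_comp]
    rw [Strict.assoc, Strict.assoc, ← hT.classifies.comm, m_comp_map_comp, hT.isAlgebra.assoc,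
      ← Strict.assoc, hωp, Strict.assoc]
  have hTTs := hT.isLeftTightPullback hK hu (hT.isLeftTightPullback hK hu hs)
  rw [T.map_id, T.map_id] at hTTs
  have hs' : T.map (T.map s) ≫ T.map ωp ≫ ωp = T.map (T.map s ≫ ωp) ≫ ωp := by
    rw [T.map_comp, Strict.assoc]
  have hTTc : ((c.map T).map T).src = T.map (T.map π) ≫ T.map (T.map s) := by
    rw [map_src, map_src, hsrc, T.map_comp, T.map_comp]
  refine IsDiscreteOpfibration.hom_ext_of_point hu.isDiscreteOpfibration hTTc
    (by rw [map_tgt, map_tgt, htgt, T.map_id, T.map_id]) h ?_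
  rw [hs']
  refine hTTs.eq_section ?_
  rw [Strict.assoc, h, ← Strict.assoc, hs', ← hTTs.comm, Strict.id_comp]

theorem isAlgebra_top (hT : T.LiftsClassifier S u ωp ω) (hK : IsPlumbus K)
    (hu : S.IsTwoClassifier u) : T.IsAlgebra ωp := by
  refine ⟨hu.tight_of_comp hu.small ?_, hT.i_comp_top hK hu, hT.m_comp_top hK hu⟩
  rw [← hT.classifies.comm]
  exact Enhanced.tight_comp _ _ (T.map_tight u hu.isTightDiscreteOpfibration.1) hT.isAlgebra.tight

end Top

variable {Ωp Ω A B : AlgLx T} {U : Ωp ⟶ Ω} {P : A ⟶ B}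

open LaxHom

section Laxators

variable {f : B.carrier ⟶ Ω.carrier} {e : A.carrier ⟶ Ωp.carrier}
  {φ : T.map f ≫ Ω.str ⟶ B.str ≫ f} {l : T.map e ≫ Ωp.str ⟶ A.str ≫ e}

theorem whiskerLeft_i_eq (hK : IsPlumbus K) (hu : S.IsTwoClassifier (map U))
    (h : IsLeftTightPullback (map P) e f (map U)) (hw : T.map (map P) ◀ of φ = of l ▶ map U) :
    T.i B.carrier ◀ of φ = of (𝟙 f) ∧ T.i A.carrier ◀ of l = of (𝟙 e) := by
  refine (hu.isInitialSquare hK h).cells_ext ?_ rfl (B.isAlgebra.unit_comp f) ?_ rfl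
    (A.isAlgebra.unit_comp e) ?_ ?_
  · exact (i_comp_map_comp ..).trans (by rw [Ω.isAlgebra.unit, Strict.comp_id])
  · exact (i_comp_map_comp ..).trans (by rw [Ωp.isAlgebra.unit, Strict.comp_id])
  · rw [whiskerLeft_whiskerLeft, ← T.i_naturality, ← whiskerLeft_whiskerLeft, hw,
      whiskerLeft_whiskerRight]
  · rw [whiskerLeft_of_id, whiskerRight_of_id, h.comm]

theorem isVComp_whiskerLeft_m (hT : T.LiftsClassifier S (map U) Ωp.str Ω.str) (hK : IsPlumbus K)
    (hu : S.IsTwoClassifier (map U)) (hU : IsStrict U) (hP : IsStrict P)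
    (h : IsLeftTightPullback (map P) e f (map U)) (hw : T.map (map P) ◀ of φ = of l ▶ map U) :
    IsVComp ((of φ).map T ▶ Ω.str) (T.map B.str ◀ of φ) (T.m B.carrier ◀ of φ) ∧
      IsVComp ((of l).map T ▶ Ωp.str) (T.map A.str ◀ of l) (T.m A.carrier ◀ of l) := by
  obtain ⟨c, hc⟩ := IsVComp.exists_of_tgt_eq_src (c := (of φ).map T ▶ Ω.str)
    (d := T.map B.str ◀ of φ) (by simp [T.map_comp])
  obtain ⟨d, hd⟩ := IsVComp.exists_of_tgt_eq_src (c := (of l).map T ▶ Ωp.str)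
    (d := T.map A.str ◀ of l) (by simp [T.map_comp])
  have hcd : T.map (T.map (map P)) ◀ c = d ▶ map U := by
    have hPc := hc.whiskerLeft (T.map (T.map (map P)))
    rw [← whiskerLeft_whiskerRight, ← map_whiskerLeft, hw, map_whiskerRight,
      whiskerRight_whiskerRight, hU.comm, ← whiskerRight_whiskerRight, whiskerLeft_whiskerLeft,
      ← T.map_comp, hP.comm, T.map_comp, ← whiskerLeft_whiskerLeft, hw,
      ← whiskerLeft_whiskerRight] at hPc
    exact hPc.unique (hd.whiskerRight (map U))
  have hTTh := hT.isLeftTightPullback hK hu (hT.isLeftTightPullback hK hu h)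
  obtain ⟨hφ, hl⟩ := (hu.isInitialSquare hK hTTh).cells_ext (φ := T.m B.carrier ◀ of φ) (φ' := c)
    (l := T.m A.carrier ◀ of l) (l' := d)
    (by simp [m_comp_map_comp, Ω.isAlgebra.assoc, T.map_comp])
    hc.src_eq ((B.isAlgebra.assoc_comp f).trans hc.tgt_eq.symm)
    (by simp [m_comp_map_comp, Ωp.isAlgebra.assoc, T.map_comp])
    hd.src_eq ((A.isAlgebra.assoc_comp e).trans hd.tgt_eq.symm)
    (by rw [whiskerLeft_whiskerLeft, ← T.m_naturality, ← whiskerLeft_whiskerLeft, hw,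
      whiskerLeft_whiskerRight]) hcd
  rw [hφ, hl]
  exact ⟨hc, hd⟩

end Laxators

theorem exists_comp_eq_comp (hT : T.LiftsClassifier S (map U) Ωp.str Ω.str) (hK : IsPlumbus K)
    (hu : S.IsTwoClassifier (map U)) (hU : IsStrict U) (hP : IsStrict P)
    {f : B.carrier ⟶ Ω.carrier} {e : A.carrier ⟶ Ωp.carrier}
    (h : IsLeftTightPullback (map P) e f (map U)) :
    ∃ (F : B ⟶ Ω) (E : A ⟶ Ωp), map F = f ∧ map E = e ∧ P ≫ F = E ≫ U := by
  have comm : T.map (map P) ≫ B.str ≫ f = (A.str ≫ e) ≫ map U := by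
    rw [← Strict.assoc, hP.comm, Strict.assoc, h.comm, Strict.assoc]
  obtain ⟨φ, l, hw⟩ := (hu.isInitialSquare hK (hT.isLeftTightPullback hK hu h)).exists_cells comm
  obtain ⟨hφi, hli⟩ := whiskerLeft_i_eq hK hu h hw
  obtain ⟨hφm, hlm⟩ := hT.isVComp_whiskerLeft_m hK hu hU hP h hw
  obtain ⟨F, rfl, hF⟩ := exists_of_laxCell f (of φ) rfl rfl hφi hφm
  obtain ⟨E, rfl, hE⟩ := exists_of_laxCell e (of l) rfl rfl hli hlm
  exact ⟨F, E, rfl, rfl, (hP.comp_eq_comp_iff hU h.comm).2 (by rw [hF, hE, hw])⟩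

variable {F : B ⟶ Ω} {E : A ⟶ Ωp}

theorem eq_of_comp_eq_comp (hT : T.LiftsClassifier S (map U) Ωp.str Ω.str) (hK : IsPlumbus K)
    (hu : S.IsTwoClassifier (map U)) (hU : IsStrict U) (hP : IsStrict P)
    (h : IsLeftTightPullback (map P) (map E) (map F) (map U)) (comm : P ≫ F = E ≫ U)
    {F' : B ⟶ Ω} {E' : A ⟶ Ωp} (hF : map F' = map F) (hE : map E' = map E)
    (comm' : P ≫ F' = E' ≫ U) : F' = F :=
  ext_laxCell hF
    ((hu.isInitialSquare hK (hT.isLeftTightPullback hK hu h)).cells_ext (by simp [hF]) rfl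
      (by simp [hF]) (by simp [hE]) rfl (by simp [hE])
      ((hP.comp_eq_comp_iff hU (congrArg map comm')).1 comm')
      ((hP.comp_eq_comp_iff hU h.comm).1 comm)).1

theorem isPseudo_iff_isTwoPullback (hT : T.LiftsClassifier S (map U) Ωp.str Ω.str)
    (hK : IsPlumbus K) (hu : S.IsTwoClassifier (map U)) (hU : IsStrict U) (hP : IsStrict P)
    (h : IsLeftTightPullback (map P) (map E) (map F) (map U)) (comm : P ≫ F = E ≫ U) :
    IsPseudo F ↔ IsTwoPullback (T.map (map P)) A.str B.str (map P) :=
  hu.isIso_iff_isTwoPullback hK (hT.isLeftTightPullback hK hu h) h hP.comm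
    ((hP.comp_eq_comp_iff hU h.comm).1 comm)

end LiftsClassifier

end EnhancedTwoMonad

end Algebras

open EnhancedTwoMonad in
theorem mainTheorem3 {K : Type u} [Bicategory.{w, v} K] [Strict K] [Enhanced K]
    (hK : IsPlumbus K) (S : PullbackIdeal K) {Ωp Ω : K} (u : Ωp ⟶ Ω) (hu : S.IsTwoClassifier u)
    (T : EnhancedTwoMonad K) (ωp : T.obj Ωp ⟶ Ωp) (ω : T.obj Ω ⟶ Ω)
    (hT : T.LiftsClassifier S u ωp ω)
    (X B : AlgLx T) (b : ColaxHom X B) (C : RepComma b.map) (hC : S.small C.cod) :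
    ∃ (hΩp : T.IsAlgebra ωp) (hγ : T.IsAlgebra (b.commaStr C)),
      let algΩp : AlgLx T := ⟨Ωp, ωp, hΩp⟩
      let algΩ : AlgLx T := ⟨Ω, ω, hT.isAlgebra⟩
      let algC : AlgLx T := ⟨C.pt, b.commaStr C, hγ⟩
      let U : algΩp ⟶ algΩ := LaxHom.ofStrict u hT.classifies.comm
      let D : algC ⟶ B := LaxHom.ofStrict C.cod (b.commaStr_spec C).2.1.symm
      IsTightDiscreteOpfibration D ∧
      ∀ (f : B.carrier ⟶ Ω) (e : C.pt ⟶ Ωp), IsLeftTightPullback C.cod e f u →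
        ∃ F : B ⟶ algΩ,
          (LaxHom.map F = f ∧ ∃ E : algC ⟶ algΩp, LaxHom.map E = e ∧ IsLeftTightPullback D E F U) ∧
          (∀ F' : B ⟶ algΩ, (LaxHom.map F' = f ∧
            ∃ E : algC ⟶ algΩp, LaxHom.map E = e ∧ IsLeftTightPullback D E F' U) → F' = F) ∧
          (LaxHom.IsPseudo F ↔ b.IsCartesianAt) := by
  have hΩp := hT.isAlgebra_top hK hu
  have hCd := S.isTightDiscreteOpfibration C.cod hC
  have hγ := b.isAlgebra_commaStr C <| hu.tight_of_comp hC <| by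
    rw [b.commaStr_cod]
    exact Enhanced.tight_comp _ _ (T.map_tight _ hCd.1) B.isAlgebra.tight
  refine ⟨hΩp, hγ, ?_⟩
  intro algΩp algΩ algC U D
  have hU : LaxHom.IsStrict U :=
    LaxHom.isStrict_ofStrict (A := algΩp) (B := algΩ) u hT.classifies.comm
  have hD : LaxHom.IsStrict D :=
    LaxHom.isStrict_ofStrict (A := algC) C.cod (b.commaStr_cod C).symm
  refine ⟨⟨LaxHom.tight_iff.2 ⟨hCd.1, hD⟩, hD.isDiscreteOpfibration hCd.2⟩, fun f e h => ?_⟩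
  obtain ⟨F, E, rfl, rfl, comm⟩ :=
    LiftsClassifier.exists_comp_eq_comp (U := U) hT hK hu hU hD h
  have hTD : IsDiscreteOpfibration (T.map C.cod) :=
    (hT.isLeftTightPullback hK hu h).isDiscreteOpfibration hu.isDiscreteOpfibration
  refine ⟨F, ⟨rfl, E, rfl, hD.isLeftTightPullback hU hu.isDiscreteOpfibration comm h⟩, ?_, ?_⟩
  · rintro F' ⟨hF, E', hE, h'⟩
    exact LiftsClassifier.eq_of_comp_eq_comp (U := U) hT hK hu hU hD h comm hF hE h'.comm
  · exact (LiftsClassifier.isPseudo_iff_isTwoPullback (U := U) hT hK hu hU hD h comm).trans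
      (b.isCartesianAt_iff_isTwoPullback C hTD).symm
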